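/- Let $q$ be a complex number with $0<|q|<1$. Write $(u;q)_k=\prod_{j=0}^{k-1}(1-uq^j)$ and $(u;q)_{-k}=\prod_{j=1}^{k}(1-uq^{-j})^{-1}$ for integers $k\ge 0$, and $${}_{r+1}\phi_r\left[\begin{matrix}a_1,\dots,a_{r+1}\\ b_1,\dots,b_r\end{matrix};q,x\right]=\sum_{i\ge 0}\frac{(a_1;q)_i\cdots(a_{r+1};q)_i}{(b_1;q)_i\cdots(b_r;q)_i}\frac{x^i}{(q;q)_i}.$$ Let $n,s\ge 0$ be integers, let $\mathbf k=(k_1,\dots,k_s)$ be positive integers with $|\mathbf k|=k_1+\dots+k_s$, and let $w$ and $z_1,\dots,z_s$ be nonzero complex numbers, the $z_l$ pairwise distinct, such that no denominator below vanishes (the ${}_{2s+2}\phi_{2s+1}$ terminates, its terms of index $i>n$ being $0$). Then \begin{multline*} \frac{(qw^2;q^2)_n}{(w^2;q)_n}\, \prod_{l=1}^s \frac{(q^{-k_l}w/z_l;q)_n}{(w/z_l;q)_n}\; {}_{2s+2}\phi_{2s+1}\left[\begin{matrix} w^2/q,\ q^{-n},\ \{w/z_l,\ q^{k_l}wz_l\}_{1\le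 l\le s}\\ q^nw^2,\ \{wz_l,\ q^{-k_l}w/z_l\}_{1\le l\le s}\end{matrix};q,-q^{n-|\mathbf k|+1}\right]\\ =q^{-\binom{|\mathbf k|}{2}}\,(-q;q)_{n-|\mathbf k|}\, \prod_{1\le a<b\le s}\frac{(q^{k_b+1}z_az_b;q)_{k_a}}{(qz_az_b;q)_{k_a}}\, \prod_{a=1}^s\frac{(qz_a^2;q^2)_{k_a}}{(qz_a^2;q)_{k_a}}\\ \times\sum_{\mathbf m\le\mathbf k}(-1)^{|\mathbf m|}\,c_{\mathbf m}\,q^{(|\mathbf k|-n)|\mathbf m|}\, \prod_{l=1}^s\frac{(q^nwz_l;q)_{m_l}}{(wz_l;q)_{m_l}}\,\frac{(qz_l/w;q)_{m_l}}{(q^{1-n}z_l/w;q)_{m_l}}, \end{multline*} where the sum is over all $\mathbf m=(m_1,\dots,m_s)\in\mathbb{Z}_{\ge 0}^s$ with $m_l\le k_l$ for all $l$, $|\mathbf m|=m_1+\dots+m_s$, and $$c_{\mathbf m}=\prod_{1\le a<b\le s}\frac{q^{m_a}z_a-q^{m_b}z_b}{z_a-z_b}\, \prod_{1\le a\le b\le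 s}\frac{1-q^{m_a+m_b}z_az_b}{1-z_az_b}\, \prod_{a,b=1}^s\frac{(q^{-k_b}z_a/z_b;q)_{m_a}}{(qz_a/z_b;q)_{m_a}}\,\frac{(z_az_b;q)_{m_a}}{(q^{1+k_b}z_az_b;q)_{m_a}}.$$ -/

import Mathlib

open scoped BigOperators

/-- The `q`-shifted factorial `(a; q)_k = (1 - a) (1 - a q) ⋯ (1 - a q ^ (k - 1))`, `k : ℕ`. -/
noncomputable def qPoch (a q : ℂ) (k : ℕ) : ℂ :=
  ∏ j ∈ Finset.range k, (1 - a * q ^ j)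

/-- The `q`-shifted factorial `(a; q)_k` for an integer `k`; for negative index
`(a; q)_{-k} = 1 / ((1 - a q ^ (-1)) (1 - a q ^ (-2)) ⋯ (1 - a q ^ (-k)))`. For `0 < |q| < 1`
this is `(a; q)_∞ / (a q ^ k; q)_∞` in both cases, whenever that quotient is defined. -/
noncomputable def qPochInt (a q : ℂ) : ℤ → ℂ
  | Int.ofNat k => qPoch a q k
  | Int.negSucc k => (∏ j ∈ Finset.range (k + 1), (1 - a * q ^ (-((j : ℤ) + 1))))⁻¹

/-- The `i`-th term of the series `_{r+1}φ_r [a; b; q, x]`. -/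
noncomputable def phiTerm {r : ℕ} (a : Fin (r + 1) → ℂ) (b : Fin r → ℂ) (q x : ℂ) (i : ℕ) : ℂ :=
  (∏ j, qPoch (a j) q i) / (∏ j, qPoch (b j) q i) * (x ^ i / qPoch q q i)

/-- The basic hypergeometric series `_{r+1}φ_r [a; b; q, x]`. -/
noncomputable def phi {r : ℕ} (a : Fin (r + 1) → ℂ) (b : Fin r → ℂ) (q x : ℂ) : ℂ :=
  ∑' i : ℕ, phiTerm a b q x i

/-- The upper parameters `w²/q, q^{-n}, {w/z_l, q^{k_l} w z_l}` (there are `2 s + 2` of them). -/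
noncomputable def upperParams {s : ℕ} (n : ℕ) (k : Fin s → ℕ) (q w : ℂ) (z : Fin s → ℂ) :
    Fin (s + s + 1 + 1) → ℂ :=
  Fin.cons (w ^ 2 / q) (Fin.cons (q ^ (-(n : ℤ)))
    (Fin.append (fun l => w / z l) (fun l => q ^ k l * w * z l)))

/-- The lower parameters `q^n w², {w z_l, q^{-k_l} w/z_l}` (there are `2 s + 1` of them). -/
noncomputable def lowerParams {s : ℕ} (n : ℕ) (k : Fin s → ℕ) (q w : ℂ) (z : Fin s → ℂ) :
    Fin (s + s + 1) → ℂ :=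
  Fin.cons (q ^ n * w ^ 2)
    (Fin.append (fun l => w * z l) (fun l => q ^ (-(k l : ℤ)) * w / z l))

/-- The coefficient `c_m` of the `C_s` basic hypergeometric sum. -/
noncomputable def cCoeff {s : ℕ} (k : Fin s → ℕ) (q : ℂ) (z : Fin s → ℂ) (m : Fin s → ℕ) : ℂ :=
  (∏ a, ∏ b ∈ Finset.Ioi a, (q ^ m a * z a - q ^ m b * z b) / (z a - z b)) *
  (∏ a, ∏ b ∈ Finset.Ici a, (1 - q ^ (m a + m b) * z a * z b) / (1 - z a * z b)) *
  (∏ a, ∏ b,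
    qPoch (q ^ (-(k b : ℤ)) * z a / z b) q (m a) / qPoch (q * z a / z b) q (m a) *
    (qPoch (z a * z b) q (m a) / qPoch (q ^ (1 + k b) * z a * z b) q (m a)))

/-!
Let `x ↦ 1 / (q x)` act on `ℂˣ`, with invariant `x + 1 / (q x)`. Up to a common factor, the series
is the value of a linear functional, given by the weights of the terminating Bailey–Daum series on
the lattice `ξ_i = q^{i-1} w + 1 / (q^i w)`, at the polynomial `∏ t, (ξ - y_t - 1 / (q y_t))` whose
`y_t` run through the geometric progressions `z_l, z_l q, …, z_l q^{k_l - 1}`.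

For generic `y_t` this value is a sum over all ways of reflecting some of the `y_t`, and both sides
satisfy the same recursion in the number of variables. For the functional, split the last factor as
`(ξ - ξ_0) + (ξ_0 - y_t - 1 / (q y_t))`: the first part shifts `w` and `n`. For the sum, the
recursion is an identity between polynomials in the parameter `q^n w`, which holds by induction at
enough points of the orbits of the `y_t`.

In the geometric progressions an unreflected point annihilates a reflected predecessor. Hence only
the `m_l` first points of each progression are unreflected, the remaining sum is over `m ≤ k`, and
the products of pair weights telescope to `c_m`.
-/

section DiagonalProducts

variable {ι M : Type*} [LinearOrder ι] [Fintype ι] [LocallyFiniteOrderTop ι] [CommMonoid M]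

theorem prod_prod_eq_diag_mul_Ioi [LocallyFiniteOrderBot ι] (F : ι → ι → M) :
    ∏ a, ∏ b, F a b = (∏ a, F a a) * ∏ a, ∏ b ∈ Finset.Ioi a, F a b * F b a := by
  rw [Finset.prod_prod_Ioi_mul_eq_prod_prod_off_diag fun b a => F a b, ← Finset.prod_mul_distrib]
  refine Finset.prod_congr rfl fun a _ => ?_
  rw [← Finset.mul_prod_erase _ _ (Finset.mem_univ a), Finset.compl_singleton]

theorem prod_Ici_eq_diag_mul_Ioi (F : ι → ι → M) :
    ∏ a, ∏ b ∈ Finset.Ici a, F a b = (∏ a, F a a) * ∏ a, ∏ b ∈ Finset.Ioi a, F a b := by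
  rw [← Finset.prod_mul_distrib]
  refine Finset.prod_congr rfl fun a _ => ?_
  rw [← Finset.Ioi_insert, Finset.prod_insert Finset.notMem_Ioi_self]

end DiagonalProducts

section PairProducts

variable {ι M : Type*} [LinearOrder ι] [CommMonoid M]

/-- The product of `g a b` over the pairs `a < b` of elements of `T`. -/
def pairProd (T : Finset ι) (g : ι → ι → M) : M :=
  ∏ a ∈ T, ∏ b ∈ T with a < b, g a b

theorem pairProd_congr {T : Finset ι} {g h : ι → ι → M}
    (H : ∀ a ∈ T, ∀ b ∈ T, a < b → g a b = h a b) : pairProd T g = pairProd T h :=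
  Finset.prod_congr rfl fun a ha => Finset.prod_congr rfl fun b hb =>
    H a ha b (Finset.mem_filter.1 hb).1 (Finset.mem_filter.1 hb).2

theorem pairProd_insert {T : Finset ι} {t : ι} (ht : t ∉ T) {g : ι → ι → M}
    (hg : ∀ a b, g a b = g b a) :
    pairProd (insert t T) g = (∏ a ∈ T, g a t) * pairProd T g := by
  simp only [pairProd, Finset.prod_filter]
  simp only [Finset.prod_insert ht, lt_irrefl, if_false, one_mul, Finset.prod_mul_distrib]
  rw [← mul_assoc, ← Finset.prod_mul_distrib]
  congr 1
  refine Finset.prod_congr rfl fun a ha => ?_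
  rcases lt_or_gt_of_ne (ne_of_mem_of_not_mem ha ht) with h | h
  · simp [h, h.not_gt]
  · simp [h, h.not_gt, hg t a]

end PairProducts

section ReflectionSums

variable {ι K : Type*} [Field K]

/-- The involution `x ↦ 1 / (q x)`, the reflection under which `orbitSum` is invariant. -/
def reflect (q x : K) : K := (q * x)⁻¹

/-- The invariant `x + 1 / (q x)` of the reflection `x ↦ 1 / (q x)`. -/
def orbitSum (q x : K) : K := x + reflect q x

/-- The interaction of two variables in a type `C` sum; it vanishes when `x y = 1`, that is when
`y` is the reflection of `q⁻¹ x`. -/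
def pairWeight (q x y : K) : K := q * (1 - x * y) / (1 - q * x * y)

theorem reflect_reflect {q : K} (hq : q ≠ 0) (x : K) : reflect q (reflect q x) = x := by
  simp only [reflect, mul_inv, inv_inv, inv_mul_cancel_left₀ hq]

theorem reflect_ne_zero {q x : K} (hq : q ≠ 0) (hx : x ≠ 0) : reflect q x ≠ 0 :=
  inv_ne_zero (mul_ne_zero hq hx)

theorem pairWeight_comm (q x y : K) : pairWeight q x y = pairWeight q y x := by
  simp only [pairWeight, mul_comm, mul_left_comm]

theorem pairWeight_reflect_left {q x : K} (hq : q ≠ 0) (hx : x ≠ 0) (y : K) :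
    pairWeight q (reflect q x) y = (q * x - y) / (x - y) := by
  rw [pairWeight, reflect, mul_inv, mul_inv_cancel_left₀ hq,
    ← mul_div_mul_left _ (1 - x⁻¹ * y) hx]
  congr 1 <;> field_simp

theorem pairWeight_reflect_reflect {q x y : K} (hq : q ≠ 0) (hx : x ≠ 0) (hy : y ≠ 0) :
    pairWeight q (reflect q x) (reflect q y) = (1 - q ^ 2 * x * y) / (1 - q * x * y) := by
  rw [pairWeight_reflect_left hq hx, ← mul_div_mul_left _ _ (neg_ne_zero.2 (mul_ne_zero hq hy)),
    reflect]
  congr 1 <;> field_simp <;> ring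

variable [LinearOrder ι]

/-- The point of the orbit of `y p` selected by the set `S` of unreflected indices. -/
def signedPoint (q : K) (y : ι → K) (S : Finset ι) (p : ι) : K :=
  if p ∈ S then y p else reflect q (y p)

/-- The summand of `reflectionSum` for a family `x` of orbit points. -/
def reflectionTerm (q : K) (T : Finset ι) (f : K → K) (x : ι → K) : K :=
  (∏ p ∈ T, f (x p)) * pairProd T fun a b => pairWeight q (x a) (x b)

/-- The sum over all ways of reflecting some of the variables `y p`, `p ∈ T`, of the product of the
weights `f` of the single points and of their pair weights. -/
def reflectionSum (q : K) (y : ι → K) (T : Finset ι) (f : K → K) : K :=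
  ∑ S ∈ T.powerset, reflectionTerm q T f (signedPoint q y S)

theorem reflectionTerm_congr {q : K} {T : Finset ι} {f g : K → K} {x x' : ι → K}
    (hfg : ∀ p ∈ T, f (x p) = g (x' p)) (hx : ∀ p ∈ T, x p = x' p) :
    reflectionTerm q T f x = reflectionTerm q T g x' := by
  rw [reflectionTerm, reflectionTerm, Finset.prod_congr rfl hfg,
    pairProd_congr fun a ha b hb _ => by rw [hx a ha, hx b hb]]

theorem reflectionTerm_insert (q : K) {T : Finset ι} {t : ι} (ht : t ∉ T) (f : K → K)
    (x : ι → K) :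
    reflectionTerm q (insert t T) f x =
      f (x t) * reflectionTerm q T (fun p => f p * pairWeight q p (x t)) x := by
  rw [reflectionTerm, reflectionTerm, pairProd_insert ht fun a b => pairWeight_comm q _ _,
    Finset.prod_insert ht, Finset.prod_mul_distrib]
  ring

theorem reflectionSum_empty (q : K) (y : ι → K) (f : K → K) : reflectionSum q y ∅ f = 1 := by
  simp [reflectionSum, reflectionTerm, pairProd]

theorem reflectionSum_congr {q : K} {y : ι → K} {T : Finset ι} {f g : K → K}
    (h : ∀ p ∈ T, ∀ x, x = y p ∨ x = reflect q (y p) → f x = g x) :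
    reflectionSum q y T f = reflectionSum q y T g :=
  Finset.sum_congr rfl fun S _ => reflectionTerm_congr
    (fun p hp => h p hp _ (by rw [signedPoint]; split_ifs <;> simp)) fun _ _ => rfl

theorem reflectionSum_const_mul (q : K) (y : ι → K) (T : Finset ι) (f : K → K) (c : K) :
    reflectionSum q y T (fun x => c * f x) = c ^ T.card * reflectionSum q y T f := by
  simp only [reflectionSum, reflectionTerm, Finset.mul_sum, Finset.prod_mul_distrib,
    Finset.prod_const, mul_assoc]

theorem reflectionSum_insert (q : K) (y : ι → K) {T : Finset ι} {t : ι} (ht : t ∉ T)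
    (f : K → K) :
    reflectionSum q y (insert t T) f =
      f (reflect q (y t)) * reflectionSum q y T (fun x => f x * pairWeight q x (reflect q (y t))) +
      f (y t) * reflectionSum q y T (fun x => f x * pairWeight q x (y t)) := by
  simp only [reflectionSum]
  rw [Finset.sum_powerset_insert ht, Finset.mul_sum, Finset.mul_sum]
  congr 1 <;> refine Finset.sum_congr rfl fun S hS => ?_
  · have htS : t ∉ S := fun h => ht (Finset.mem_powerset.1 hS h)
    rw [reflectionTerm_insert q ht, signedPoint, if_neg htS]
  · rw [reflectionTerm_insert q ht, signedPoint, if_pos (Finset.mem_insert_self _ _)]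
    have hpoint : ∀ p ∈ T, signedPoint q y (insert t S) p = signedPoint q y S p := fun p hp => by
      simp [signedPoint, ne_of_mem_of_not_mem hp ht]
    exact congrArg _ (reflectionTerm_congr (fun p hp => by rw [hpoint p hp]) hpoint)

theorem reflectionSum_insert_of_mem_orbit {q : K} (hq : q ≠ 0) (y : ι → K) {T : Finset ι} {t : ι}
    (ht : t ∉ T) {x : K} (hx : x = y t ∨ x = reflect q (y t)) (f : K → K) :
    reflectionSum q y (insert t T) f =
      f (reflect q x) * reflectionSum q y T (fun p => f p * pairWeight q p (reflect q x)) +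
      f x * reflectionSum q y T (fun p => f p * pairWeight q p x) := by
  rw [reflectionSum_insert q y ht]
  rcases hx with rfl | rfl
  · rfl
  · rw [reflect_reflect hq, add_comm]

end ReflectionSums

section TypeCSums

variable {ι K : Type*} [Field K]

/-- The variables `y p`, `p ∈ T`, are nonzero and all points of their orbits under the reflection
`x ↦ 1 / (q x)` are distinct. -/
structure Generic (q : K) (y : ι → K) (T : Finset ι) : Prop where
  ne_zero : ∀ a ∈ T, y a ≠ 0
  injOn : Set.InjOn y T
  one_sub_ne : ∀ a ∈ T, ∀ b ∈ T, 1 - q * y a * y b ≠ 0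

theorem Generic.mono {q : K} {y : ι → K} {S T : Finset ι} (h : Generic q y T) (hST : S ⊆ T) :
    Generic q y S :=
  ⟨fun a ha => h.ne_zero a (hST ha), h.injOn.mono hST,
    fun a ha b hb => h.one_sub_ne a (hST ha) b (hST hb)⟩

theorem Generic.one_sub_mul_ne_zero {q : K} (hq : q ≠ 0) {y : ι → K} {T : Finset ι}
    (h : Generic q y T) {a b : ι} (ha : a ∈ T) (hb : b ∈ T) (hab : a ≠ b) {x x' : K}
    (hx : x = y a ∨ x = reflect q (y a)) (hx' : x' = y b ∨ x' = reflect q (y b)) :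
    1 - q * x * x' ≠ 0 := by
  have hya := h.ne_zero a ha
  have hyb := h.ne_zero b hb
  have hne : y a ≠ y b := fun e => hab (h.injOn ha hb e)
  have hone := h.one_sub_ne a ha b hb
  intro h0
  rcases hx with rfl | rfl <;> rcases hx' with rfl | rfl <;> (try rw [reflect] at h0) <;>
    (try rw [reflect] at h0) <;> field_simp at h0
  · exact hone (by linear_combination h0)
  · exact hne (by linear_combination -h0)
  · exact hne (by linear_combination h0)
  · exact hone (by linear_combination -h0)

theorem Generic.card_image_union_image {q : K} (hq : q ≠ 0) [DecidableEq K] {y : ι → K}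
    {T : Finset ι} (h : Generic q y T) :
    (T.image (fun t => q * y t) ∪ T.image (fun t => q * reflect q (y t))).card = 2 * T.card := by
  rw [Finset.card_union_of_disjoint, Finset.card_image_of_injOn, Finset.card_image_of_injOn,
    two_mul]
  · exact fun a ha b hb e => h.injOn ha hb
      ((reflect_reflect hq _).symm.trans
        ((congrArg _ (mul_left_cancel₀ hq e)).trans (reflect_reflect hq _)))
  · exact fun a ha b hb e => h.injOn ha hb (mul_left_cancel₀ hq e)
  · rw [Finset.disjoint_left]
    intro x hxa hxb
    obtain ⟨a, ha, rfl⟩ := Finset.mem_image.1 hxa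
    obtain ⟨b, hb, hab⟩ := Finset.mem_image.1 hxb
    have hb0 := h.ne_zero b hb
    refine h.one_sub_ne a ha b hb ?_
    rw [← hab, reflect]
    field_simp
    ring

/-- The weight of a single point in a type `C` sum with parameters `α` and `β`. -/
def pointWeight (q α β x : K) : K := -((1 - α * x) * (1 - β * x)) / (q * x)

variable [LinearOrder ι]

/-- The type `C` sum with parameters `α` and `β`, into which `baileyFunctional` expands on
products of factors `ξ - orbitSum q (y t)`. -/
def typeCSum (q : K) (y : ι → K) (T : Finset ι) (α β : K) : K :=
  reflectionSum q y T (pointWeight q α β)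

/-- Only the terms containing the point `x` survive when `α = q x`, and the remaining factors
recombine into a type `C` sum with `α = x`. -/
theorem typeCSum_insert_of_mem_orbit {q : K} (hq : q ≠ 0) {y : ι → K} {T : Finset ι} {t : ι}
    (ht : t ∉ T) (h : Generic q y (insert t T)) {x : K} (hx : x = y t ∨ x = reflect q (y t))
    (β : K) :
    typeCSum q y (insert t T) (q * x) β =
      pointWeight q (q * x) β x * (q ^ T.card * typeCSum q y T x β) := by
  have hmem := Finset.mem_insert_self t T
  have hx0 : x ≠ 0 := by
    rcases hx with rfl | rfl
    exacts [h.ne_zero t hmem, reflect_ne_zero hq (h.ne_zero t hmem)]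
  have hvanish : pointWeight q (q * x) β (reflect q x) = 0 := by
    simp [pointWeight, reflect, hq, hx0, -mul_inv_rev]
  rw [typeCSum, reflectionSum_insert_of_mem_orbit hq y ht hx, hvanish, zero_mul, zero_add,
    typeCSum, ← reflectionSum_const_mul]
  congr 1
  refine reflectionSum_congr fun p hp x' hx' => ?_
  have hden := h.one_sub_mul_ne_zero hq (Finset.mem_insert_of_mem hp) hmem
    (ne_of_mem_of_not_mem hp ht) hx' hx
  have hx'0 : x' ≠ 0 := by
    have hyp := h.ne_zero p (Finset.mem_insert_of_mem hp)
    rcases hx' with rfl | rfl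
    exacts [hyp, reflect_ne_zero hq hyp]
  have hden' : 1 - q * x * x' ≠ 0 := by rwa [mul_right_comm]
  rw [pointWeight, pointWeight, pairWeight]
  field_simp

open Polynomial in
theorem exists_polynomial_eval_eq_typeCSum (q : K) (y : ι → K) (T : Finset ι) (β : K) :
    ∃ P : K[X], P.natDegree ≤ T.card ∧ ∀ α, P.eval α = typeCSum q y T α β := by
  let F : K → K[X] := fun x => C (-(1 - β * x) / (q * x)) * (1 - C x * X)
  have hF : ∀ x, (F x).natDegree ≤ 1 := fun x => by simp only [F]; compute_degree
  refine ⟨∑ S ∈ T.powerset, (∏ p ∈ T, F (signedPoint q y S p)) * C (pairProd T fun a b =>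
    pairWeight q (signedPoint q y S a) (signedPoint q y S b)), ?_, fun α => ?_⟩
  · refine natDegree_sum_le_of_forall_le _ _ fun S _ => ?_
    refine (natDegree_mul_C_le _ _).trans ((natDegree_prod_le _ _).trans ?_)
    exact (Finset.sum_le_sum fun p _ => hF _).trans (by simp)
  · simp only [typeCSum, reflectionSum, reflectionTerm, eval_finsetSum, eval_mul, eval_C, eval_prod]
    refine Finset.sum_congr rfl fun S _ => congrArg (· * _) (Finset.prod_congr rfl fun p _ => ?_)
    simp only [F, pointWeight, eval_mul, eval_C, eval_sub, eval_one, eval_X]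
    ring

/-- The right-hand side of the recursion `typeCSum_insert`, which peels off the variable `v`. -/
def typeCPeel (q : K) (y : ι → K) (T : Finset ι) (v α β : K) : K :=
  q ^ T.card * ((1 - α * β / q) * (β / q - β⁻¹) * typeCSum q y T α (β / q) +
    (orbitSum q β⁻¹ - orbitSum q v) * (1 + α * β / q ^ (T.card + 1)) * typeCSum q y T α β)

open Polynomial in
theorem exists_polynomial_eval_eq_typeCPeel (q : K) (y : ι → K) (T : Finset ι) (v β : K) :
    ∃ P : K[X], P.natDegree ≤ T.card + 1 ∧ ∀ α, P.eval α = typeCPeel q y T v α β := by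
  obtain ⟨Q, hQdeg, hQ⟩ := exists_polynomial_eval_eq_typeCSum q y T (β / q)
  obtain ⟨R, hRdeg, hR⟩ := exists_polynomial_eval_eq_typeCSum q y T β
  refine ⟨C (q ^ T.card * (β / q - β⁻¹)) * ((1 - C (β / q) * X) * Q) +
    C (q ^ T.card * (orbitSum q β⁻¹ - orbitSum q v)) *
      ((1 + C (β / q ^ (T.card + 1)) * X) * R), ?_, fun α => ?_⟩
  · have hlin (c : K) : (1 - C c * X).natDegree ≤ 1 := by compute_degree
    have hlin' (c : K) : (1 + C c * X).natDegree ≤ 1 := by compute_degree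
    refine natDegree_add_le_of_degree_le ?_ ?_ <;>
      refine (natDegree_C_mul_le _ _).trans (natDegree_mul_le.trans ?_)
    · linarith [hlin (β / q)]
    · linarith [hlin' (β / q ^ (T.card + 1))]
  · simp only [typeCPeel, eval_add, eval_mul, eval_C, eval_sub, eval_one, eval_X, hQ, hR]
    ring

theorem typeCSum_singleton_eq_peel {q : K} (hq : q ≠ 0) {y : ι → K} {u : ι} (hu : y u ≠ 0)
    (α : K) {β : K} (hβ : β ≠ 0) :
    typeCSum q y (insert u ∅) α β = typeCPeel q y ∅ (y u) α β := by
  simp only [typeCPeel, typeCSum, reflectionSum_insert q y (Finset.notMem_empty u),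
    reflectionSum_empty, pointWeight, orbitSum, reflect, Finset.card_empty]
  field_simp
  ring

theorem typeCSum_pair_eq_peel {q : K} (hq : q ≠ 0) {y : ι → K} {t u : ι}
    (htu : u ∉ ({t} : Finset ι)) (h : Generic q y (insert u {t})) (α : K) {β : K} (hβ : β ≠ 0) :
    typeCSum q y (insert u {t}) α β = typeCPeel q y {t} (y u) α β := by
  have hyu : y u ≠ 0 := h.ne_zero u (by simp)
  have hyt : y t ≠ 0 := h.ne_zero t (by simp)
  have hne : y t - y u ≠ 0 := sub_ne_zero.2 fun e => htu (by simp [h.injOn (by simp) (by simp) e])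
  have hone := h.one_sub_ne u (by simp) t (by simp)
  have hpr : pairWeight q (y t) (reflect q (y u)) = (y t - q * y u) / (y t - y u) := by
    rw [pairWeight_comm, pairWeight_reflect_left hq hyu, ← neg_div_neg_eq, neg_sub, neg_sub]
  simp only [typeCPeel, typeCSum, reflectionSum_insert q y htu, Finset.card_singleton]
  simp only [← insert_empty_eq t, reflectionSum_insert q y (Finset.notMem_empty t),
    reflectionSum_empty, hpr, pairWeight_reflect_reflect hq hyt hyu]
  simp only [pairWeight_reflect_left hq hyt]
  simp only [pairWeight, pointWeight, orbitSum, reflect]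
  generalize y t = a at *
  generalize y u = b at *
  field_simp
  ring

/-- The induction step at an interpolation node: for `α = q x` with `x` in the orbit of `y t`, both
sides reduce to the recursion with `t` removed and `α = x`. -/
theorem typeCSum_eq_peel_of_mem_orbit {q : K} (hq : q ≠ 0) {y : ι → K} {T : Finset ι} {t u : ι}
    (ht : t ∉ T) (hu : u ∉ insert t T) (h : Generic q y (insert u (insert t T))) {x : K}
    (hx : x = y t ∨ x = reflect q (y t)) (β : K)
    (ih : typeCSum q y (insert u T) x β = typeCPeel q y T (y u) x β) :
    typeCSum q y (insert u (insert t T)) (q * x) β =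
      typeCPeel q y (insert t T) (y u) (q * x) β := by
  have hgen := h.mono (Finset.subset_insert u _)
  have htu : t ∉ insert u T := by
    rintro hmem
    rcases Finset.mem_insert.1 hmem with rfl | hmem
    exacts [hu (Finset.mem_insert_self _ _), ht hmem]
  have hweight : (1 - x * β) * pointWeight q (q * x) (β / q) x =
      (1 - x * β / q) * pointWeight q (q * x) β x := by
    simp only [pointWeight]
    ring
  rw [Finset.insert_comm] at h
  rw [Finset.insert_comm, typeCSum_insert_of_mem_orbit hq htu h hx, ih, typeCPeel, typeCPeel,
    typeCSum_insert_of_mem_orbit hq ht hgen hx, typeCSum_insert_of_mem_orbit hq ht hgen hx,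
    Finset.card_insert_of_notMem fun hmem => hu (Finset.mem_insert_of_mem hmem),
    Finset.card_insert_of_notMem ht]
  have hα : q * x * β / q = x * β := by field_simp
  have hα' : q * x * β / q ^ (T.card + 1 + 1) = x * β / q ^ (T.card + 1) := by
    field_simp
    ring
  rw [hα, hα']
  linear_combination (-q ^ (2 * T.card + 1) * (β / q - β⁻¹) * typeCSum q y T x (β / q)) * hweight

/-- The recursion is an identity between polynomials in `α`, of degree at most `|T| + 1`. By
induction on `|T|` it holds at the `2 |T|` points `q x` with `x` in the orbit of some `y t`. -/
theorem typeCSum_insert {q : K} (hq : q ≠ 0) {y : ι → K} {T : Finset ι} {u : ι} (hu : u ∉ T)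
    (h : Generic q y (insert u T)) (α : K) {β : K} (hβ : β ≠ 0) :
    typeCSum q y (insert u T) α β = typeCPeel q y T (y u) α β := by
  classical
  induction hN : T.card generalizing T α with
  | zero =>
    obtain rfl := Finset.card_eq_zero.1 hN
    exact typeCSum_singleton_eq_peel hq (h.ne_zero u (Finset.mem_insert_self _ _)) α hβ
  | succ N ih =>
    rcases Nat.eq_zero_or_pos N with rfl | hNpos
    · obtain ⟨t, rfl⟩ := Finset.card_eq_one.1 hN
      exact typeCSum_pair_eq_peel hq hu h α hβ
    have hnode : ∀ t ∈ T, ∀ x, x = y t ∨ x = reflect q (y t) →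
        typeCSum q y (insert u T) (q * x) β = typeCPeel q y T (y u) (q * x) β := by
      intro t ht x hx
      obtain ⟨T, htT, rfl⟩ : ∃ T', t ∉ T' ∧ insert t T' = T :=
        ⟨T.erase t, Finset.notMem_erase _ _, Finset.insert_erase ht⟩
      rw [Finset.card_insert_of_notMem htT, add_left_inj] at hN
      exact typeCSum_eq_peel_of_mem_orbit hq htT hu h hx β
        (ih (fun hmem => hu (Finset.mem_insert_of_mem hmem))
          (h.mono (Finset.insert_subset_insert _ (Finset.subset_insert _ _))) x hN)
    obtain ⟨P, hPdeg, hP⟩ := exists_polynomial_eval_eq_typeCSum q y (insert u T) β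
    obtain ⟨Q, hQdeg, hQ⟩ := exists_polynomial_eval_eq_typeCPeel q y T (y u) β
    have hPQ : P = Q := by
      refine Polynomial.eq_of_natDegree_lt_card_of_eval_eq' P Q
        (T.image (fun t => q * y t) ∪ T.image (fun t => q * reflect q (y t))) ?_ ?_
      · intro x hx
        rw [hP, hQ]
        rcases Finset.mem_union.1 hx with hx | hx <;> obtain ⟨t, ht, rfl⟩ := Finset.mem_image.1 hx
        exacts [hnode t ht _ (.inl rfl), hnode t ht _ (.inr rfl)]
      · rw [(h.mono (Finset.subset_insert _ _)).card_image_union_image hq]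
        rw [Finset.card_insert_of_notMem hu] at hPdeg
        omega
    rw [← hP, hPQ, hQ]

end TypeCSums

section Pochhammer

theorem qPoch_succ (a q : ℂ) (k : ℕ) : qPoch a q (k + 1) = qPoch a q k * (1 - a * q ^ k) :=
  Finset.prod_range_succ _ _

theorem qPoch_succ' (a q : ℂ) (k : ℕ) : qPoch a q (k + 1) = (1 - a) * qPoch (a * q) q k := by
  simp only [qPoch, Finset.prod_range_succ', pow_zero, mul_one, pow_succ', mul_assoc, mul_comm]

theorem one_sub_mul_qPoch (a q : ℂ) (k : ℕ) :
    (1 - a) * qPoch (a * q) q k = qPoch a q k * (1 - a * q ^ k) := by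
  rw [← qPoch_succ', qPoch_succ]

theorem qPoch_ne_zero_iff {a q : ℂ} {k : ℕ} :
    qPoch a q k ≠ 0 ↔ ∀ j < k, 1 - a * q ^ j ≠ 0 := by
  simp [qPoch, Finset.prod_ne_zero_iff]

theorem one_sub_pow_ne_zero {q : ℂ} (hq : ¬IsOfFinOrder q) {k : ℕ} (hk : k ≠ 0) :
    1 - q ^ k ≠ 0 := fun h =>
  hq (isOfFinOrder_iff_pow_eq_one.2 ⟨k, Nat.pos_of_ne_zero hk, (sub_eq_zero.1 h).symm⟩)

theorem pow_injective_of_not_isOfFinOrder {q : ℂ} (hq0 : q ≠ 0) (hq : ¬IsOfFinOrder q) :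
    Function.Injective fun i : ℕ => q ^ i := by
  have hunit : ¬IsOfFinOrder (Units.mk0 q hq0) := mt Units.isOfFinOrder_val.2 hq
  exact fun i j hij => injective_pow_iff_not_isOfFinOrder.2 hunit (Units.ext (by simpa using hij))

theorem one_add_zpow_ne_zero {q : ℂ} (hq : ¬IsOfFinOrder q) (k : ℤ) : 1 + q ^ k ≠ 0 := by
  intro h
  obtain ⟨m, hm⟩ : ∃ m : ℕ, q ^ m = -1 := by
    obtain ⟨m, rfl | rfl⟩ := k.eq_nat_or_neg
    · exact ⟨m, by linear_combination (by simpa using h : 1 + q ^ m = 0)⟩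
    · rw [zpow_neg, zpow_natCast, add_comm, add_eq_zero_iff_eq_neg] at h
      exact ⟨m, by rw [← inv_inv (q ^ m), h, inv_neg_one]⟩
  rcases eq_or_ne m 0 with rfl | hm0
  · norm_num at hm
  · exact one_sub_pow_ne_zero hq (mul_ne_zero hm0 two_ne_zero) (by rw [pow_mul, hm]; norm_num)

theorem qPochInt_neg_succ {q : ℂ} (hq0 : q ≠ 0) (hq : ¬IsOfFinOrder q) (N : ℤ) :
    qPochInt (-q) q (N + 1) = qPochInt (-q) q N * (1 + q ^ (N + 1)) := by
  obtain k | k := N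
  · rw [show (Int.ofNat k + 1 : ℤ) = Int.ofNat (k + 1) from rfl]
    simp only [qPochInt, qPoch_succ, Int.ofNat_eq_natCast, zpow_natCast, pow_succ']
    ring
  · have hlast : (1 : ℂ) - -q * q ^ (-((k : ℤ) + 1)) = 1 + q ^ (Int.negSucc k + 1) := by
      rw [Int.negSucc_eq, add_comm (-((k : ℤ) + 1)) 1, zpow_add₀ hq0, zpow_one]
      ring
    simp only [qPochInt]
    rw [Finset.prod_range_succ, hlast, mul_inv, mul_assoc,
      inv_mul_cancel₀ (one_add_zpow_ne_zero hq _), mul_one]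
    cases k with
    | zero => simp [qPoch]
    | succ k => rfl

theorem qPoch_add (a q : ℂ) (m n : ℕ) :
    qPoch a q (m + n) = qPoch a q m * qPoch (a * q ^ m) q n := by
  simp only [qPoch, Finset.prod_range_add, pow_add, mul_assoc]

theorem qPoch_ne_zero_of_le {a q : ℂ} {m n : ℕ} (hmn : m ≤ n) (h : qPoch a q n ≠ 0) :
    qPoch a q m ≠ 0 :=
  qPoch_ne_zero_iff.2 fun j hj => qPoch_ne_zero_iff.1 h j (hj.trans_le hmn)

theorem qPoch_zpow_neg_eq_zero {q : ℂ} (hq : q ≠ 0) {n i : ℕ} (h : n < i) :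
    qPoch (q ^ (-(n : ℤ))) q i = 0 := by
  refine Finset.prod_eq_zero (Finset.mem_range.2 h) ?_
  rw [zpow_neg, zpow_natCast, inv_mul_cancel₀ (pow_ne_zero n hq), sub_self]

theorem qPoch_mul_qPoch_inv {q a : ℂ} (hq : q ≠ 0) (ha : a ≠ 0) (k i : ℕ) :
    q ^ (i * k) * qPoch (q ^ (1 - (i : ℤ)) * a) q k * qPoch (q ^ (-(k : ℤ)) / a) q i =
      qPoch (q * a) q k * qPoch a⁻¹ q i := by
  induction i with
  | zero => simp [qPoch]
  | succ i ih =>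
    have hshift := one_sub_mul_qPoch (q ^ (-(i : ℤ)) * a) q k
    rw [show q ^ (-(i : ℤ)) * a * q = q ^ (1 - (i : ℤ)) * a by
      rw [sub_eq_neg_add, zpow_add_one₀ hq, mul_right_comm]] at hshift
    rw [show 1 - ((i + 1 : ℕ) : ℤ) = -(i : ℤ) by push_cast; ring, qPoch_succ _ _ i,
      qPoch_succ _ _ i, ← mul_assoc (qPoch (q * a) q k), ← ih]
    generalize qPoch (q ^ (1 - (i : ℤ)) * a) q k = P at *
    generalize qPoch (q ^ (-(i : ℤ)) * a) q k = P' at *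
    generalize qPoch (q ^ (-(k : ℤ)) / a) q i = A at *
    simp only [zpow_neg, zpow_natCast] at *
    field_simp at hshift ⊢
    linear_combination q ^ k * A * q ^ (i * k) * hshift

end Pochhammer

section BaileyDaum

/-- The summand of the terminating Bailey–Daum series
`₂φ₁[w² / q, q ^ (-n); q ^ n w²; q, -q ^ (n + 1)]`. -/
noncomputable def baileyTerm (q w : ℂ) (n i : ℕ) : ℂ :=
  qPoch (w ^ 2 / q) q i * qPoch (q ^ (-(n : ℤ))) q i /
    (qPoch q q i * qPoch (q ^ n * w ^ 2) q i) * (-q ^ (n + 1)) ^ i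

/-- The point of the quadratic lattice attached to the index `i`. -/
noncomputable def latticePoint (q w : ℂ) (i : ℕ) : ℂ := orbitSum q (q ^ i * w / q)

/-- The linear functional defined by the Bailey–Daum weights on the quadratic lattice, normalized
so that its value at `1` is `(-q; q)_n`. -/
noncomputable def baileyFunctional (q w : ℂ) (n : ℕ) (P : ℂ → ℂ) : ℂ :=
  qPoch (q * w ^ 2) (q ^ 2) n / qPoch (w ^ 2) q n *
    ∑ i ∈ Finset.range (n + 1), baileyTerm q w n i * P (latticePoint q w i)

variable {q w : ℂ}

theorem latticePoint_succ (q w : ℂ) (i : ℕ) :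
    latticePoint q w (i + 1) = latticePoint q (q * w) i := by
  rw [latticePoint, latticePoint, pow_succ, mul_assoc]

theorem latticePoint_add_sub (hq0 : q ≠ 0) (hw : w ≠ 0) (i d : ℕ) :
    latticePoint q w (i + d + 1) - latticePoint q w i =
      (1 - q ^ (d + 1)) * (1 - w ^ 2 * q ^ (2 * i + d)) / (q ^ (i + d + 1) * w) := by
  simp only [latticePoint, orbitSum, reflect]
  field_simp
  ring

theorem baileyTerm_succ (hq0 : q ≠ 0) (hq : ¬IsOfFinOrder q) (hw : w ≠ 0) (n i : ℕ) :
    baileyTerm q w (n + 1) (i + 1) * (latticePoint q w (i + 1) - latticePoint q w 0) =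
      (1 - w ^ 2 / q) * (1 - w ^ 2) * (1 - q ^ (n + 1)) / (w * (1 - q ^ (n + 1) * w ^ 2)) *
        baileyTerm q (q * w) n i := by
  have hlattice := latticePoint_add_sub hq0 hw 0 i
  rw [zero_add, mul_zero, zero_add] at hlattice
  have hden : qPoch (q ^ (n + 1) * w ^ 2) q (i + 1) =
      (1 - q ^ (n + 1) * w ^ 2) * qPoch (q ^ n * (q * w) ^ 2) q i := by
    rw [qPoch_succ', show q ^ (n + 1) * w ^ 2 * q = q ^ n * (q * w) ^ 2 by ring]
  have hnum : (1 - w ^ 2) * qPoch ((q * w) ^ 2 / q) q i =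
      qPoch (w ^ 2) q i * (1 - w ^ 2 * q ^ i) := by
    rw [← one_sub_mul_qPoch, show (q * w) ^ 2 / q = w ^ 2 * q by field_simp]
  have hnum' : qPoch (q ^ (-((n + 1 : ℕ) : ℤ))) q (i + 1) =
      -((1 - q ^ (n + 1)) / q ^ (n + 1) * qPoch (q ^ (-(n : ℤ))) q i) := by
    rw [qPoch_succ', ← zpow_add_one₀ hq0, show -((n + 1 : ℕ) : ℤ) + 1 = -(n : ℤ) by push_cast; ring,
      zpow_neg, zpow_natCast]
    field_simp
    ring
  have hpow : (-q ^ (n + 1 + 1)) ^ (i + 1) = -q ^ (n + 1 + 1) * (q ^ i * (-q ^ (n + 1)) ^ i) := by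
    rw [pow_succ', ← mul_pow]
    ring
  have hi := one_sub_pow_ne_zero hq (Nat.succ_ne_zero i)
  rw [baileyTerm, baileyTerm, hlattice, hden, hnum', hpow, qPoch_succ', div_mul_cancel₀ _ hq0,
    qPoch_succ q q i, ← pow_succ', div_mul_eq_mul_div, mul_assoc (1 - w ^ 2 / q)]
  generalize qPoch ((q * w) ^ 2 / q) q i = A at *
  generalize qPoch (w ^ 2) q i = B at *
  generalize (1 : ℂ) - q ^ (n + 1) * w ^ 2 = C
  generalize qPoch q q i = D
  generalize qPoch (q ^ n * (q * w) ^ 2) q i = E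
  generalize qPoch (q ^ (-(n : ℤ))) q i = F
  generalize (-q ^ (n + 1)) ^ i = G
  generalize (1 : ℂ) - q ^ (n + 1) = H
  field_simp
  linear_combination (-((q - w ^ 2) * H * F * q ^ (n + 1 + 1) * q ^ i * G / (D * C * E))) * hnum

theorem baileyTerm_add (hq0 : q ≠ 0) (hq : ¬IsOfFinOrder q) (hw : w ≠ 0) {i d : ℕ}
    (h0 : 1 - w ^ 2 * q ^ (i + d) ≠ 0) (h1 : 1 - w ^ 2 * q ^ (2 * i + d) ≠ 0) :
    baileyTerm q w (i + d + 1) i * (latticePoint q w i - latticePoint q w (i + d + 1)) =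
      (1 - (q ^ (i + d + 1))⁻¹) * (1 - w ^ 2 * q ^ (i + d)) / w * baileyTerm q w (i + d) i := by
  have hd := one_sub_pow_ne_zero hq (Nat.succ_ne_zero d)
  have hnum : qPoch (q ^ (-((i + d + 1 : ℕ) : ℤ))) q i * (1 - q ^ (d + 1)) =
      -(q ^ (d + 1) * (1 - (q ^ (i + d + 1))⁻¹) * qPoch (q ^ (-((i + d : ℕ) : ℤ))) q i) := by
    have h := one_sub_mul_qPoch (q ^ (-((i + d + 1 : ℕ) : ℤ))) q i
    rw [← zpow_add_one₀ hq0, Nat.cast_succ, neg_add, neg_add_cancel_right, ← neg_add,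
      ← Nat.cast_succ] at h
    have hpole : q ^ (-((i + d + 1 : ℕ) : ℤ)) * q ^ i = (q ^ (d + 1))⁻¹ := by
      rw [zpow_neg, zpow_natCast, add_assoc, pow_add q i]
      field_simp
    have hinv : (q ^ (i + d + 1))⁻¹ = q ^ (-((i + d + 1 : ℕ) : ℤ)) := by
      rw [zpow_neg, zpow_natCast]
    rw [hinv, mul_assoc, h, hpole]
    generalize qPoch (q ^ (-((i + d + 1 : ℕ) : ℤ))) q i = A
    field_simp
    ring
  have hden : qPoch (q ^ (i + d) * w ^ 2) q i * (1 - w ^ 2 * q ^ (2 * i + d)) =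
      (1 - w ^ 2 * q ^ (i + d)) * qPoch (q ^ (i + d + 1) * w ^ 2) q i := by
    have h := one_sub_mul_qPoch (q ^ (i + d) * w ^ 2) q i
    rw [show q ^ (i + d) * w ^ 2 * q = q ^ (i + d + 1) * w ^ 2 by ring] at h
    linear_combination -h
  have hpow : (-q ^ (i + d + 1 + 1)) ^ i = (-q ^ (i + d + 1)) ^ i * q ^ i := by
    rw [← mul_pow]
    ring
  rw [baileyTerm, baileyTerm, ← neg_sub, latticePoint_add_sub hq0 hw, hpow,
    eq_div_of_mul_eq h1 hden, eq_div_of_mul_eq hd hnum]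
  generalize qPoch (q ^ (-((i + d : ℕ) : ℤ))) q i = A
  generalize qPoch (q ^ (i + d + 1) * w ^ 2) q i = B
  generalize (1 : ℂ) - w ^ 2 * q ^ (i + d) = C at h0 ⊢
  field_simp
  ring

theorem baileyFunctional_add (P Q : ℂ → ℂ) (n : ℕ) :
    baileyFunctional q w n (fun ξ => P ξ + Q ξ) =
      baileyFunctional q w n P + baileyFunctional q w n Q := by
  simp only [baileyFunctional, mul_add, Finset.sum_add_distrib]

theorem baileyFunctional_const_mul (P : ℂ → ℂ) (c : ℂ) (n : ℕ) :
    baileyFunctional q w n (fun ξ => c * P ξ) = c * baileyFunctional q w n P := by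
  simp only [baileyFunctional, mul_left_comm _ c, ← Finset.mul_sum]

theorem baileyFunctional_shift (hq0 : q ≠ 0) (hq : ¬IsOfFinOrder q) (hw : w ≠ 0) {n : ℕ}
    (h : ∀ j < 2 * (n + 1), 1 - w ^ 2 * q ^ j ≠ 0) (P : ℂ → ℂ) :
    baileyFunctional q w (n + 1) (fun ξ => (ξ - latticePoint q w 0) * P ξ) =
      (1 - q ^ (n + 1)) * (1 - w ^ 2 / q) / w * baileyFunctional q (q * w) n P := by
  have h0 : 1 - w ^ 2 ≠ 0 := by simpa using h 0 (by omega)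
  have h1 : 1 - w ^ 2 * q ≠ 0 := by simpa using h 1 (by omega)
  have hn' := h (n + 1) (by omega)
  have hn : 1 - q ^ (n + 1) * w ^ 2 ≠ 0 := by rwa [mul_comm]
  have hden : qPoch (w ^ 2) q (n + 1) * (1 - q ^ (n + 1) * w ^ 2) =
      (1 - w ^ 2) * ((1 - w ^ 2 * q) * qPoch ((q * w) ^ 2) q n) := by
    rw [mul_comm (q ^ (n + 1)), ← qPoch_succ, qPoch_succ', qPoch_succ',
      show (q * w) ^ 2 = w ^ 2 * q * q by ring]
  have hnum : qPoch (q * w ^ 2) (q ^ 2) (n + 1) =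
      (1 - w ^ 2 * q) * qPoch (q * (q * w) ^ 2) (q ^ 2) n := by
    rw [qPoch_succ', mul_comm q (w ^ 2), show w ^ 2 * q * q ^ 2 = q * (q * w) ^ 2 by ring]
  have hterm : ∀ i ∈ Finset.range (n + 1), baileyTerm q w (n + 1) (i + 1) *
      ((latticePoint q w (i + 1) - latticePoint q w 0) * P (latticePoint q w (i + 1))) =
      (1 - w ^ 2 / q) * (1 - w ^ 2) * (1 - q ^ (n + 1)) / (w * (1 - q ^ (n + 1) * w ^ 2)) *
        (baileyTerm q (q * w) n i * P (latticePoint q (q * w) i)) := fun i _ => by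
    rw [← mul_assoc, baileyTerm_succ hq0 hq hw, latticePoint_succ, mul_assoc]
  rw [baileyFunctional, baileyFunctional, Finset.sum_range_succ', sub_self, zero_mul, mul_zero,
    add_zero, Finset.sum_congr rfl hterm, ← Finset.mul_sum, hnum, eq_div_of_mul_eq hn hden]
  field_simp

theorem baileyFunctional_shift_last (hq0 : q ≠ 0) (hq : ¬IsOfFinOrder q) (hw : w ≠ 0) {n : ℕ}
    (h : ∀ j < 2 * (n + 1), 1 - w ^ 2 * q ^ j ≠ 0) (P : ℂ → ℂ) :
    baileyFunctional q w (n + 1) (fun ξ => (ξ - latticePoint q w (n + 1)) * P ξ) =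
      (1 - (q ^ (n + 1))⁻¹) * (1 - w ^ 2 * q ^ (2 * n + 1)) / w * baileyFunctional q w n P := by
  have hn := h n (by omega)
  have hterm : ∀ i ∈ Finset.range (n + 1), baileyTerm q w (n + 1) i *
      ((latticePoint q w i - latticePoint q w (n + 1)) * P (latticePoint q w i)) =
      (1 - (q ^ (n + 1))⁻¹) * (1 - w ^ 2 * q ^ n) / w *
        (baileyTerm q w n i * P (latticePoint q w i)) := by
    intro i hi
    obtain ⟨d, rfl⟩ := Nat.exists_eq_add_of_le (Nat.lt_succ_iff.1 (Finset.mem_range.1 hi))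
    rw [← mul_assoc, baileyTerm_add hq0 hq hw hn (h _ (by omega)), mul_assoc]
  rw [baileyFunctional, baileyFunctional, Finset.sum_range_succ, sub_self, zero_mul, mul_zero,
    add_zero, Finset.sum_congr rfl hterm, ← Finset.mul_sum, qPoch_succ, qPoch_succ,
    show q * w ^ 2 * (q ^ 2) ^ n = w ^ 2 * q ^ (2 * n + 1) by ring]
  field_simp

theorem baileyFunctional_one (hq0 : q ≠ 0) (hq : ¬IsOfFinOrder q) (hw : w ≠ 0) {n : ℕ}
    (h : ∀ j < 2 * n, 1 - w ^ 2 * q ^ j ≠ 0) :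
    baileyFunctional q w n (fun _ => 1) = qPoch (-q) q n := by
  induction n generalizing w with
  | zero => simp [baileyFunctional, baileyTerm, qPoch]
  | succ n ih =>
    have hfirst := baileyFunctional_shift hq0 hq hw h fun _ => 1
    have hlast := baileyFunctional_shift_last hq0 hq hw h fun _ => 1
    rw [ih (mul_ne_zero hq0 hw) fun j hj => by
      rw [show (q * w) ^ 2 * q ^ j = w ^ 2 * q ^ (j + 2) by ring]
      exact h (j + 2) (by omega)] at hfirst
    rw [ih hw fun j hj => h j (by omega)] at hlast
    have hsub := latticePoint_add_sub hq0 hw 0 n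
    rw [zero_add, mul_zero, zero_add] at hsub
    have hne : latticePoint q w (n + 1) - latticePoint q w 0 ≠ 0 := by
      rw [hsub]
      exact div_ne_zero (mul_ne_zero (one_sub_pow_ne_zero hq n.succ_ne_zero) (h n (by omega)))
        (mul_ne_zero (pow_ne_zero _ hq0) hw)
    have hsplit : (fun ξ => (ξ - latticePoint q w 0) * 1) = fun ξ =>
        (ξ - latticePoint q w (n + 1)) * 1 +
        (latticePoint q w (n + 1) - latticePoint q w 0) * 1 := by
      funext ξ
      ring
    rw [hsplit, baileyFunctional_add, baileyFunctional_const_mul, hlast] at hfirst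
    refine mul_left_cancel₀ hne ((eq_sub_of_add_eq' hfirst).trans ?_)
    rw [hsub, qPoch_succ]
    field_simp
    ring

/-- The functional reproduces the recursion `typeCSum_insert`: write
`ξ - orbitSum q (y u) = (ξ - ξ₀) + (ξ₀ - orbitSum q (y u))` with the first lattice point `ξ₀`. -/
theorem baileyFunctional_prod {ι : Type*} [LinearOrder ι] (hq0 : q ≠ 0) (hq : ¬IsOfFinOrder q)
    (hw : w ≠ 0) {n : ℕ} (h : ∀ j < 2 * n, 1 - w ^ 2 * q ^ j ≠ 0) {y : ι → ℂ} {T : Finset ι}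
    (hT : Generic q y T) :
    baileyFunctional q w n (fun ξ => ∏ t ∈ T, (ξ - orbitSum q (y t))) =
      qPochInt (-q) q ((n : ℤ) - T.card) * (q ^ T.card.choose 2)⁻¹ *
        typeCSum q y T (q ^ n * w) (q / w) := by
  induction T using Finset.induction_on generalizing n w with
  | empty =>
    simp [baileyFunctional_one hq0 hq hw h, typeCSum, reflectionSum_empty, qPochInt]
  | insert u T hu ih =>
    have hgT : Generic q y T := hT.mono (Finset.subset_insert _ _)
    have hsplit : (fun ξ => ∏ t ∈ insert u T, (ξ - orbitSum q (y t))) = fun ξ =>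
        (ξ - latticePoint q w 0) * ∏ t ∈ T, (ξ - orbitSum q (y t)) +
        (latticePoint q w 0 - orbitSum q (y u)) * ∏ t ∈ T, (ξ - orbitSum q (y t)) := by
      funext ξ
      rw [Finset.prod_insert hu]
      ring
    have hshift : baileyFunctional q w n
        (fun ξ => (ξ - latticePoint q w 0) * ∏ t ∈ T, (ξ - orbitSum q (y t))) =
        (1 - q ^ n) * (1 - w ^ 2 / q) / w * (qPochInt (-q) q ((n : ℤ) - (T.card + 1 : ℕ)) *
          (q ^ T.card.choose 2)⁻¹ * typeCSum q y T (q ^ n * w) (q / w / q)) := by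
      cases n with
      | zero => simp [baileyFunctional]
      | succ n =>
        rw [baileyFunctional_shift hq0 hq hw h, ih (mul_ne_zero hq0 hw) (fun j hj => by
          rw [show (q * w) ^ 2 * q ^ j = w ^ 2 * q ^ (j + 2) by ring]
          exact h (j + 2) (by omega)) hgT, Nat.cast_succ, Nat.cast_succ, add_sub_add_right_eq_sub,
          div_mul_eq_div_div_swap, pow_succ, mul_assoc (q ^ n)]
    have hcast : (n : ℤ) - T.card = (n : ℤ) - (T.card + 1 : ℕ) + 1 := by push_cast; ring
    have hzpow : q ^ ((n : ℤ) - (T.card + 1 : ℕ) + 1) = q ^ n * w * (q / w) / q ^ (T.card + 1) := by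
      rw [← hcast, zpow_sub₀ hq0, zpow_natCast, zpow_natCast]
      field_simp
      ring
    have hlattice : latticePoint q w 0 = orbitSum q (q / w)⁻¹ := by
      rw [latticePoint, pow_zero, one_mul, inv_div]
    have hcoeff : (1 - q ^ n) * (1 - w ^ 2 / q) / w =
        (1 - q ^ n * w * (q / w) / q) * (q / w / q - (q / w)⁻¹) := by
      field_simp
    rw [hsplit, baileyFunctional_add, baileyFunctional_const_mul, hshift, ih hw h hgT, hcast,
      qPochInt_neg_succ hq0 hq, hzpow, typeCSum_insert hq0 hu hT _ (div_ne_zero hq0 hw), typeCPeel,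
      Finset.card_insert_of_notMem hu, Nat.choose_succ_succ' T.card 1, Nat.choose_one_right,
      pow_add q T.card (T.card.choose _), mul_inv, hlattice, hcoeff]
    field_simp

end BaileyDaum

section SegmentBlocks

/-- The `j`-th point `v q ^ j` of a segment, reflected unless `j < l`. -/
noncomputable def segmentPoint (q v : ℂ) (l j : ℕ) : ℂ :=
  if j < l then v * q ^ j else reflect q (v * q ^ j)

variable {q u v x : ℂ}

theorem prod_pairWeight_mul_pow {l : ℕ} (h : ∀ j < l, 1 - q * x * (v * q ^ j) ≠ 0) :
    (∏ j ∈ Finset.range l, pairWeight q x (v * q ^ j)) * (1 - x * (v * q ^ l)) =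
      q ^ l * (1 - x * v) := by
  induction l with
  | zero => simp
  | succ l ih =>
    have hl := h l l.lt_succ_self
    rw [show x * (v * q ^ (l + 1)) = q * x * (v * q ^ l) by ring, Finset.prod_range_succ,
      pairWeight, mul_assoc, div_mul_cancel₀ _ hl, mul_left_comm,
      ih fun j hj => h j (hj.trans l.lt_succ_self), pow_succ', mul_assoc]

theorem prod_pairWeight_reflect_mul_pow (hq : q ≠ 0) {d : ℕ}
    (h : ∀ j < d, 1 - q * x * reflect q (v * q ^ j) ≠ 0) :
    (∏ j ∈ Finset.range d, pairWeight q x (reflect q (v * q ^ j))) * (1 - x * v⁻¹) =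
      q ^ d * (1 - x * (v * q ^ d)⁻¹) := by
  have hcancel : ∀ j, q * x * reflect q (v * q ^ j) = x * (v * q ^ j)⁻¹ := fun j => by
    rw [reflect, mul_inv, mul_comm q, mul_assoc, mul_inv_cancel_left₀ hq]
  induction d with
  | zero => simp
  | succ d ih =>
    have hd := h d d.lt_succ_self
    rw [Finset.prod_range_succ, mul_right_comm, ih fun j hj => h j (hj.trans d.lt_succ_self),
      pairWeight, ← hcancel, mul_assoc, mul_div_cancel₀ _ hd, reflect, ← mul_assoc, ← pow_succ,
      mul_left_comm, ← pow_succ']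

theorem prod_pairWeight_segmentPoint (hq : q ≠ 0) {l N : ℕ} (hl : l ≤ N)
    (h : ∀ j < N, 1 - q * x * segmentPoint q v l j ≠ 0) :
    (∏ j ∈ Finset.range N, pairWeight q x (segmentPoint q v l j)) *
        ((1 - x * (v * q ^ l)) * (1 - x * (v * q ^ l)⁻¹)) =
      q ^ N * ((1 - x * v) * (1 - x * (v * q ^ N)⁻¹)) := by
  obtain ⟨d, rfl⟩ := Nat.exists_eq_add_of_le hl
  have hlow : ∀ j < l, segmentPoint q v l j = v * q ^ j := fun j hj => if_pos hj
  have hhigh : ∀ j, segmentPoint q v l (l + j) = reflect q (v * q ^ l * q ^ j) := fun j => by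
    rw [segmentPoint, if_neg (by omega), mul_assoc, ← pow_add]
  have hprod_low := prod_pairWeight_mul_pow fun j hj => by
    have := h j (hj.trans_le hl)
    rwa [hlow j hj] at this
  have hprod_high := prod_pairWeight_reflect_mul_pow (d := d) hq fun j hj => by
    have := h (l + j) (by omega)
    rwa [hhigh] at this
  rw [Finset.prod_range_add, mul_mul_mul_comm, Finset.prod_congr rfl fun j hj => by
    rw [hlow j (Finset.mem_range.1 hj)]]
  simp only [hhigh]
  rw [hprod_low, hprod_high, pow_add]
  ring

theorem prod_segmentPoint_succ (f : ℂ → ℂ) {m M : ℕ} (hm : m < M) :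
    (∏ i ∈ Finset.range M, f (segmentPoint q u (m + 1) i)) * f (reflect q (u * q ^ m)) =
      (∏ i ∈ Finset.range M, f (segmentPoint q u m i)) * f (u * q ^ m) := by
  have hrest : ∀ i ∈ (Finset.range M).erase m,
      f (segmentPoint q u (m + 1) i) = f (segmentPoint q u m i) := fun i hi => by
    have := Finset.ne_of_mem_erase hi
    simp only [segmentPoint, show i < m + 1 ↔ i < m by omega]
  rw [← Finset.mul_prod_erase _ _ (Finset.mem_range.2 hm),
    ← Finset.mul_prod_erase _ (fun i => f (segmentPoint q u m i)) (Finset.mem_range.2 hm),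
    Finset.prod_congr rfl hrest, segmentPoint, segmentPoint, if_pos m.lt_succ_self,
    if_neg (lt_irrefl m)]
  ring

theorem prod_prod_pairWeight_reflect_reflect (hq : q ≠ 0) (hu : u ≠ 0) (hv : v ≠ 0) {M N : ℕ}
    (h : ∀ i < M, ∀ j < N, 1 - u * v * q ^ (i + j + 1) ≠ 0) :
    (∏ i ∈ Finset.range M, ∏ j ∈ Finset.range N,
        pairWeight q (reflect q (u * q ^ i)) (reflect q (v * q ^ j))) * qPoch (q * u * v) q M =
      qPoch (q ^ (N + 1) * u * v) q M := by
  rw [qPoch, qPoch, ← Finset.prod_mul_distrib]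
  refine Finset.prod_congr rfl fun i hi => ?_
  have hrow := prod_pairWeight_reflect_mul_pow (x := reflect q (u * q ^ i)) (v := v) (d := N) hq
    fun j hj => by
      have hne := h i (Finset.mem_range.1 hi) j hj
      rw [reflect, reflect]
      contrapose! hne
      field_simp at hne
      linear_combination -hne
  have hscale : ∀ N, 1 - q ^ (N + 1) * u * v * q ^ i =
      -(q * u * q ^ i * v) * q ^ N * (1 - reflect q (u * q ^ i) * (v * q ^ N)⁻¹) := fun N => by
    rw [reflect]
    field_simp
    ring
  have hscale0 := hscale 0
  rw [zero_add, pow_one, pow_zero, mul_one, mul_one] at hscale0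
  rw [hscale0, hscale N, mul_left_comm, hrow]
  ring

end SegmentBlocks

section CrossBlock

/-- The orbits of the points `u q ^ i`, `i ≤ M`, do not meet those of `v q ^ j`, `j ≤ N`. -/
structure DisjointSegments (q u v : ℂ) (M N : ℕ) : Prop where
  left_ne_zero : u ≠ 0
  right_ne_zero : v ≠ 0
  one_sub_ne : ∀ j ≤ M + N, 1 - u * v * q ^ j ≠ 0
  sub_ne : ∀ i ≤ M, ∀ j ≤ N, u * q ^ i - v * q ^ j ≠ 0

/-- The factor of the third product of `cCoeff` for a segment starting at `u`, of which the first
`m` points are left unreflected, and a segment of length `N` starting at `v`. -/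
noncomputable def segmentFactor (q u v : ℂ) (N m : ℕ) : ℂ :=
  qPoch (q ^ (-(N : ℤ)) * u / v) q m / qPoch (q * u / v) q m *
    (qPoch (u * v) q m / qPoch (q ^ (1 + N) * u * v) q m)

/-- The product of the pair weights between two segments of lengths `M` and `N`, of which the first
`m` and `l` points are left unreflected, relative to its value at `m = l = 0`. -/
noncomputable def crossFactor (q u v : ℂ) (M N m l : ℕ) : ℂ :=
  q ^ (N * m + M * l) * ((q ^ m * u - q ^ l * v) / (u - v)) *
    ((1 - q ^ (m + l) * u * v) / (1 - u * v)) *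
    (segmentFactor q u v N m * segmentFactor q v u M l)

variable {q u v : ℂ} {M N m l : ℕ}

theorem DisjointSegments.symm (h : DisjointSegments q u v M N) : DisjointSegments q v u N M where
  left_ne_zero := h.right_ne_zero
  right_ne_zero := h.left_ne_zero
  one_sub_ne j hj := by
    rw [mul_comm v]
    exact h.one_sub_ne j (by omega)
  sub_ne i hi j hj := by
    rw [← neg_sub]
    exact neg_ne_zero.2 (h.sub_ne j hj i hi)

theorem DisjointSegments.one_sub_mul_ne_zero (hq : q ≠ 0) (h : DisjointSegments q u v M N)
    {i j : ℕ} (hi : i < M) (hj : j < N) {x y : ℂ}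
    (hx : x = u * q ^ i ∨ x = reflect q (u * q ^ i))
    (hy : y = v * q ^ j ∨ y = reflect q (v * q ^ j)) : 1 - q * x * y ≠ 0 := by
  have hu := h.left_ne_zero
  have hv := h.right_ne_zero
  have hone := h.one_sub_ne (i + j + 1) (by omega)
  have hsub := h.sub_ne i hi.le j hj.le
  intro h0
  rcases hx with rfl | rfl <;> rcases hy with rfl | rfl <;> (try rw [reflect] at h0) <;>
    (try rw [reflect] at h0) <;> field_simp at h0
  · exact hone (by linear_combination h0)
  · exact hsub (by linear_combination -h0)
  · exact hsub (by linear_combination h0)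
  · exact hone (by linear_combination -h0)

theorem segmentPoint_eq_or (q v : ℂ) (l j : ℕ) :
    segmentPoint q v l j = v * q ^ j ∨ segmentPoint q v l j = reflect q (v * q ^ j) := by
  rw [segmentPoint]
  split_ifs <;> simp

theorem DisjointSegments.prod_pairWeight_row (hq : q ≠ 0) (h : DisjointSegments q u v M N)
    (hm : m < M)
    (hl : l ≤ N) :
    (∏ j ∈ Finset.range N, pairWeight q (u * q ^ m) (segmentPoint q v l j)) *
        ((1 - u * v * q ^ (m + l)) * (u * q ^ m - v * q ^ l)) =
      q ^ l * ((1 - u * v * q ^ m) * (u * q ^ m - v * q ^ N)) := by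
  have hv := h.right_ne_zero
  have hrow := prod_pairWeight_segmentPoint (v := v) hq hl fun j hj =>
    h.one_sub_mul_ne_zero hq hm hj (Or.inl rfl) (segmentPoint_eq_or q v l j)
  generalize ∏ j ∈ Finset.range N, pairWeight q (u * q ^ m) (segmentPoint q v l j) = R at hrow ⊢
  field_simp at hrow
  linear_combination -hrow

theorem DisjointSegments.prod_pairWeight_row_reflect (hq : q ≠ 0)
    (h : DisjointSegments q u v M N) (hm : m < M)
    (hl : l ≤ N) :
    (∏ j ∈ Finset.range N, pairWeight q (reflect q (u * q ^ m)) (segmentPoint q v l j)) *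
        ((1 - u * v * q ^ (m + 1 + l)) * (u * q ^ (m + 1) - v * q ^ l)) =
      q ^ l * ((1 - u * v * q ^ (m + 1 + N)) * (u * q ^ (m + 1) - v)) := by
  have hu := h.left_ne_zero
  have hv := h.right_ne_zero
  have hrow := prod_pairWeight_segmentPoint (v := v) hq hl fun j hj =>
    h.one_sub_mul_ne_zero hq hm hj (Or.inr rfl) (segmentPoint_eq_or q v l j)
  generalize ∏ j ∈ Finset.range N, pairWeight q (reflect q (u * q ^ m)) (segmentPoint q v l j) = R
    at hrow ⊢
  rw [reflect] at hrow
  field_simp at hrow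
  linear_combination -hrow

theorem DisjointSegments.prod_pairWeight_row_reflect_ne_zero (hq : q ≠ 0)
    (h : DisjointSegments q u v M N)
    (hm : m < M) (hl : l ≤ N) :
    ∏ j ∈ Finset.range N, pairWeight q (reflect q (u * q ^ m)) (segmentPoint q v l j) ≠ 0 := by
  intro h0
  have hrow := h.prod_pairWeight_row_reflect hq hm hl
  rw [h0, zero_mul] at hrow
  have hsub := h.sub_ne (m + 1) hm 0 N.zero_le
  rw [pow_zero, mul_one] at hsub
  exact mul_ne_zero (pow_ne_zero l hq) (mul_ne_zero (h.one_sub_ne _ (by omega)) hsub) hrow.symm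

theorem segmentFactor_succ (hq : q ≠ 0) (hv : v ≠ 0) (N m : ℕ) :
    q ^ N * segmentFactor q u v N (m + 1) =
      segmentFactor q u v N m * ((u * q ^ m - v * q ^ N) / (u * q ^ (m + 1) - v) *
        ((1 - u * v * q ^ m) / (1 - u * v * q ^ (m + 1 + N)))) := by
  have hnum : 1 - q ^ (-(N : ℤ)) * u / v * q ^ m = -(q ^ N * v)⁻¹ * (u * q ^ m - v * q ^ N) := by
    rw [zpow_neg, zpow_natCast]
    field_simp
    ring
  have hden : 1 - q * u / v * q ^ m = -v⁻¹ * (u * q ^ (m + 1) - v) := by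
    field_simp
    ring
  simp only [segmentFactor, qPoch_succ]
  rw [hnum, hden, show q ^ (1 + N) * u * v * q ^ m = u * v * q ^ (m + 1 + N) by ring]
  generalize u * q ^ m - v * q ^ N = X
  generalize u * q ^ (m + 1) - v = Y
  generalize (1 : ℂ) - u * v * q ^ (m + 1 + N) = Z
  field_simp

theorem crossFactor_comm (q u v : ℂ) (M N m l : ℕ) :
    crossFactor q u v M N m l = crossFactor q v u N M l m := by
  rw [crossFactor, crossFactor, ← neg_sub v, ← neg_sub (q ^ l * v), neg_div_neg_eq]
  ring

theorem crossFactor_zero_zero (h : DisjointSegments q u v M N) :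
    crossFactor q u v M N 0 0 = 1 := by
  have hone := h.one_sub_ne 0 (Nat.zero_le _)
  have hsub := h.sub_ne 0 M.zero_le 0 N.zero_le
  simp only [pow_zero, mul_one] at hone hsub
  simp [crossFactor, segmentFactor, qPoch, hone, hsub]

theorem DisjointSegments.crossFactor_succ_mul_row (hq : q ≠ 0) (h : DisjointSegments q u v M N)
    (hm : m < M) (hl : l ≤ N) :
    crossFactor q u v M N (m + 1) l *
        ∏ j ∈ Finset.range N, pairWeight q (reflect q (u * q ^ m)) (segmentPoint q v l j) =
      crossFactor q u v M N m l *
        ∏ j ∈ Finset.range N, pairWeight q (u * q ^ m) (segmentPoint q v l j) := by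
  have hone := h.one_sub_ne (m + l) (by omega)
  have hone' := h.one_sub_ne (m + 1 + l) (by omega)
  have honeN := h.one_sub_ne (m + 1 + N) (by omega)
  have hsub := h.sub_ne m hm.le l hl
  have hsub' := h.sub_ne (m + 1) hm l hl
  have hsub0 := h.sub_ne (m + 1) hm 0 N.zero_le
  rw [pow_zero, mul_one] at hsub0
  have hfactor := segmentFactor_succ (u := u) hq h.right_ne_zero N m
  rw [eq_div_of_mul_eq (mul_ne_zero hone hsub) (h.prod_pairWeight_row hq hm hl),
    eq_div_of_mul_eq (mul_ne_zero hone' hsub') (h.prod_pairWeight_row_reflect hq hm hl)]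
  simp only [crossFactor]
  rw [show q ^ (N * (m + 1) + M * l) = q ^ (N * m + M * l) * q ^ N by ring,
    show q ^ m * u - q ^ l * v = u * q ^ m - v * q ^ l by ring,
    show q ^ (m + 1) * u - q ^ l * v = u * q ^ (m + 1) - v * q ^ l by ring,
    show q ^ (m + l) * u * v = u * v * q ^ (m + l) by ring,
    show q ^ (m + 1 + l) * u * v = u * v * q ^ (m + 1 + l) by ring]
  generalize segmentFactor q u v N (m + 1) = A at *
  generalize u * q ^ m - v * q ^ l = B at *
  generalize u * q ^ (m + 1) - v * q ^ l = B' at *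
  generalize (1 : ℂ) - u * v * q ^ (m + l) = C at *
  generalize (1 : ℂ) - u * v * q ^ (m + 1 + l) = C' at *
  generalize (1 : ℂ) - u * v * q ^ (m + 1 + N) = D at *
  generalize u * q ^ (m + 1) - v = E at *
  field_simp
  field_simp at hfactor
  linear_combination segmentFactor q v u M l / ((u - v) * (1 - u * v)) * hfactor

theorem DisjointSegments.prod_pairWeight_succ (hq : q ≠ 0) (h : DisjointSegments q u v M N)
    (hm : m < M) (hl : l ≤ N) {c : ℂ}
    (hc : ∏ i ∈ Finset.range M, ∏ j ∈ Finset.range N,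
      pairWeight q (segmentPoint q u m i) (segmentPoint q v l j) = c * crossFactor q u v M N m l) :
    ∏ i ∈ Finset.range M, ∏ j ∈ Finset.range N,
      pairWeight q (segmentPoint q u (m + 1) i) (segmentPoint q v l j) =
        c * crossFactor q u v M N (m + 1) l := by
  refine mul_right_cancel₀ (h.prod_pairWeight_row_reflect_ne_zero hq hm hl) ?_
  rw [prod_segmentPoint_succ (fun x => ∏ j ∈ Finset.range N,
    pairWeight q x (segmentPoint q v l j)) hm, hc, mul_assoc, mul_assoc,
    h.crossFactor_succ_mul_row hq hm hl]

theorem DisjointSegments.prod_pairWeight_of_zero (hq : q ≠ 0) (h : DisjointSegments q u v M N)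
    (hm : m ≤ M) (hl : l ≤ N) {c : ℂ}
    (hc : ∏ i ∈ Finset.range M, ∏ j ∈ Finset.range N,
      pairWeight q (segmentPoint q u 0 i) (segmentPoint q v l j) = c * crossFactor q u v M N 0 l) :
    ∏ i ∈ Finset.range M, ∏ j ∈ Finset.range N,
      pairWeight q (segmentPoint q u m i) (segmentPoint q v l j) =
        c * crossFactor q u v M N m l := by
  induction m with
  | zero => exact hc
  | succ m ih => exact h.prod_pairWeight_succ hq hm hl (ih (by omega))

theorem DisjointSegments.prod_pairWeight (hq : q ≠ 0) (h : DisjointSegments q u v M N)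
    (hm : m ≤ M) (hl : l ≤ N) :
    ∏ i ∈ Finset.range M, ∏ j ∈ Finset.range N,
      pairWeight q (segmentPoint q u m i) (segmentPoint q v l j) =
        qPoch (q ^ (N + 1) * u * v) q M / qPoch (q * u * v) q M *
          crossFactor q u v M N m l := by
  have hden : qPoch (q * u * v) q M ≠ 0 := qPoch_ne_zero_iff.2 fun j hj => by
    rw [show q * u * v * q ^ j = u * v * q ^ (j + 1) by ring]
    exact h.one_sub_ne _ (by omega)
  have hbase := eq_div_of_mul_eq hden (prod_prod_pairWeight_reflect_reflect (N := N) hq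
    h.left_ne_zero h.right_ne_zero fun i hi j hj => h.one_sub_ne _ (by omega))
  refine h.prod_pairWeight_of_zero hq hm hl ?_
  rw [Finset.prod_comm, crossFactor_comm]
  simp only [pairWeight_comm q _ (segmentPoint q v l _)]
  refine h.symm.prod_pairWeight_of_zero hq hl M.zero_le ?_
  rw [crossFactor_zero_zero h.symm, mul_one, Finset.prod_comm, ← hbase]
  simp only [segmentPoint, Nat.not_lt_zero, if_false, pairWeight_comm q (reflect q (v * _))]

end CrossBlock

section SelfBlock

/-- The product of the pair weights within a segment of length `k`, of which the first `m` points
are left unreflected, relative to its value at `m = 0`. -/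
noncomputable def selfFactor (q z : ℂ) (k m : ℕ) : ℂ :=
  (-1) ^ m * q ^ (k * m) * ((1 - q ^ (m + m) * z * z) / (1 - z * z)) * segmentFactor q z z k m

variable {q z : ℂ} {k m : ℕ}

theorem prod_range_erase {M : Type*} [CommMonoid M] (f : ℕ → M) (m d : ℕ) :
    ∏ i ∈ (Finset.range (m + 1 + d)).erase m, f i =
      (∏ i ∈ Finset.range m, f i) * ∏ j ∈ Finset.range d, f (m + 1 + j) := by
  have hf : ∀ i ≠ m, Function.update f m 1 i = f i := fun i hi => Function.update_of_ne hi _ _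
  rw [← Finset.prod_congr rfl fun i hi => hf i (Finset.ne_of_mem_erase hi),
    Finset.prod_erase _ (Function.update_self m 1 f), Finset.prod_range_add,
    Finset.prod_range_succ, Function.update_self, mul_one,
    Finset.prod_congr rfl fun i hi => hf i (Finset.mem_range.1 hi).ne,
    Finset.prod_congr rfl fun j _ => hf (m + 1 + j) (by omega)]

theorem generic_segment (hq0 : q ≠ 0) (hq : ¬IsOfFinOrder q) (hz : z ≠ 0)
    (h : ∀ j ≤ k + k, 1 - z * z * q ^ j ≠ 0) :
    Generic q (fun i => z * q ^ i) (Finset.range k) where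
  ne_zero i _ := mul_ne_zero hz (pow_ne_zero i hq0)
  injOn _ _ _ _ hij := pow_injective_of_not_isOfFinOrder hq0 hq (mul_left_cancel₀ hz hij)
  one_sub_ne i hi j hj := by
    have hi := Finset.mem_range.1 hi
    have hj := Finset.mem_range.1 hj
    rw [show q * (z * q ^ i) * (z * q ^ j) = z * z * q ^ (i + j + 1) by ring]
    exact h _ (by omega)

theorem prod_erase_pairWeight_segmentPoint (hq : q ≠ 0) (hm : m < k) {x : ℂ}
    (h : ∀ i < k, i ≠ m → 1 - q * x * segmentPoint q z m i ≠ 0) :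
    (∏ i ∈ (Finset.range k).erase m, pairWeight q x (segmentPoint q z m i)) *
        ((1 - x * (z * q ^ m)) * (1 - x * (z * q ^ (m + 1))⁻¹)) * q =
      q ^ k * ((1 - x * z) * (1 - x * (z * q ^ k)⁻¹)) := by
  obtain ⟨d, rfl⟩ := Nat.exists_eq_add_of_le (Nat.succ_le_of_lt hm)
  have hlow : ∀ j < m, segmentPoint q z m j = z * q ^ j := fun j hj => if_pos hj
  have hhigh : ∀ j, segmentPoint q z m (m + 1 + j) = reflect q (z * q ^ (m + 1) * q ^ j) :=
    fun j => by rw [segmentPoint, if_neg (by omega), mul_assoc, ← pow_add]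
  have hprod_low := prod_pairWeight_mul_pow (x := x) (v := z) fun j (hj : j < m) => by
    rw [← hlow j hj]
    exact h j (by omega) hj.ne
  have hprod_high := prod_pairWeight_reflect_mul_pow (x := x) (v := z * q ^ (m + 1)) (d := d) hq
    fun j hj => by
      rw [← hhigh]
      exact h _ (by omega) (by omega)
  rw [Nat.succ_eq_add_one, prod_range_erase, mul_mul_mul_comm, Finset.prod_congr rfl fun j hj => by
    rw [hlow j (Finset.mem_range.1 hj)]]
  simp only [hhigh]
  rw [hprod_low, hprod_high, pow_add, pow_add]
  ring

theorem prod_erase_pairWeight_row (hq0 : q ≠ 0) (hq : ¬IsOfFinOrder q) (hz : z ≠ 0)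
    (h : ∀ j ≤ k + k, 1 - z * z * q ^ j ≠ 0) (hm : m < k) :
    (∏ i ∈ (Finset.range k).erase m, pairWeight q (z * q ^ m) (segmentPoint q z m i)) *
        ((1 - z * z * q ^ (m + m)) * (q - 1)) =
      (1 - z * z * q ^ m) * (q ^ k - q ^ m) := by
  have hrow := prod_erase_pairWeight_segmentPoint hq0 hm fun i hi hne =>
    (generic_segment hq0 hq hz h).one_sub_mul_ne_zero hq0 (Finset.mem_range.2 hm)
      (Finset.mem_range.2 hi) hne.symm (Or.inl rfl) (segmentPoint_eq_or q z m i)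
  generalize ∏ i ∈ (Finset.range k).erase m,
    pairWeight q (z * q ^ m) (segmentPoint q z m i) = R at hrow ⊢
  field_simp at hrow
  refine mul_left_cancel₀ (pow_ne_zero (m + 1) hq0) ?_
  linear_combination hrow

theorem prod_erase_pairWeight_row_reflect (hq0 : q ≠ 0) (hq : ¬IsOfFinOrder q) (hz : z ≠ 0)
    (h : ∀ j ≤ k + k, 1 - z * z * q ^ j ≠ 0) (hm : m < k) :
    (∏ i ∈ (Finset.range k).erase m, pairWeight q (reflect q (z * q ^ m)) (segmentPoint q z m i)) *
        ((1 - z * z * q ^ (m + 1 + (m + 1))) * (q - 1)) =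
      (1 - z * z * q ^ (m + 1 + k)) * (q ^ (m + 1) - 1) := by
  have hrow := prod_erase_pairWeight_segmentPoint hq0 hm fun i hi hne =>
    (generic_segment hq0 hq hz h).one_sub_mul_ne_zero hq0 (Finset.mem_range.2 hm)
      (Finset.mem_range.2 hi) hne.symm (Or.inr rfl) (segmentPoint_eq_or q z m i)
  generalize ∏ i ∈ (Finset.range k).erase m,
    pairWeight q (reflect q (z * q ^ m)) (segmentPoint q z m i) = R at hrow ⊢
  rw [reflect] at hrow
  field_simp at hrow
  refine mul_left_cancel₀ (pow_ne_zero (m + 1) hq0) ?_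
  linear_combination -hrow

theorem prod_erase_pairWeight_row_reflect_ne_zero (hq0 : q ≠ 0) (hq : ¬IsOfFinOrder q) (hz : z ≠ 0)
    (h : ∀ j ≤ k + k, 1 - z * z * q ^ j ≠ 0) (hm : m < k) :
    ∏ i ∈ (Finset.range k).erase m,
      pairWeight q (reflect q (z * q ^ m)) (segmentPoint q z m i) ≠ 0 := by
  intro h0
  have hrow := prod_erase_pairWeight_row_reflect hq0 hq hz h hm
  rw [h0, zero_mul, ← neg_sub (1 : ℂ) (q ^ (m + 1)), mul_neg, eq_comm, neg_eq_zero] at hrow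
  exact mul_ne_zero (h _ (by omega)) (one_sub_pow_ne_zero hq m.succ_ne_zero) hrow

theorem pairProd_pairWeight_reflect (hq0 : q ≠ 0) (hz : z ≠ 0)
    (h : ∀ j ≤ k + k, 1 - z * z * q ^ j ≠ 0) :
    pairProd (Finset.range k) (fun i j =>
        pairWeight q (reflect q (z * q ^ i)) (reflect q (z * q ^ j))) * qPoch (q * z ^ 2) q k =
      qPoch (q * z ^ 2) (q ^ 2) k := by
  induction k with
  | zero => simp [pairProd, qPoch]
  | succ k ih =>
    have hrow := prod_pairWeight_reflect_mul_pow (x := reflect q (z * q ^ k)) (v := z) (d := k) hq0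
      fun j hj => by
        have hne := h (k + j + 1) (by omega)
        rw [reflect, reflect]
        contrapose! hne
        field_simp at hne
        linear_combination -hne
    rw [Finset.range_add_one, pairProd_insert Finset.notMem_range_self fun _ _ =>
      pairWeight_comm _ _ _]
    simp only [pairWeight_comm q _ (reflect q (z * q ^ k))]
    rw [qPoch_succ, qPoch_succ, ← ih fun j hj => h j (by omega)]
    generalize ∏ i ∈ Finset.range k,
      pairWeight q (reflect q (z * q ^ k)) (reflect q (z * q ^ i)) = R at hrow ⊢
    rw [reflect] at hrow
    field_simp at hrow
    rw [← pow_mul, pow_mul', ← neg_sub, ← neg_sub (_ * (q ^ k) ^ 2), ← hrow]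
    ring

theorem selfFactor_succ_mul_row (hq0 : q ≠ 0) (hq : ¬IsOfFinOrder q) (hz : z ≠ 0)
    (h : ∀ j ≤ k + k, 1 - z * z * q ^ j ≠ 0) (hm : m < k) :
    selfFactor q z k (m + 1) * ∏ i ∈ (Finset.range k).erase m,
        pairWeight q (reflect q (z * q ^ m)) (segmentPoint q z m i) =
      selfFactor q z k m * ∏ i ∈ (Finset.range k).erase m,
        pairWeight q (z * q ^ m) (segmentPoint q z m i) := by
  have hq1 : q - 1 ≠ 0 := by
    rw [← neg_sub]
    simpa only [pow_one] using neg_ne_zero.2 (one_sub_pow_ne_zero hq one_ne_zero)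
  have hm1 : q ^ (m + 1) - 1 ≠ 0 := by
    rw [← neg_sub]
    exact neg_ne_zero.2 (one_sub_pow_ne_zero hq m.succ_ne_zero)
  have hone := h (m + m) (by omega)
  have hone' := h (m + 1 + (m + 1)) (by omega)
  have honek := h (m + 1 + k) (by omega)
  have hfactor := segmentFactor_succ (u := z) hq0 hz k m
  rw [eq_div_of_mul_eq (mul_ne_zero hone hq1) (prod_erase_pairWeight_row hq0 hq hz h hm),
    eq_div_of_mul_eq (mul_ne_zero hone' hq1) (prod_erase_pairWeight_row_reflect hq0 hq hz h hm)]
  simp only [selfFactor]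
  rw [show q ^ (k * (m + 1)) = q ^ (k * m) * q ^ k by ring,
    show q ^ (m + m) * z * z = z * z * q ^ (m + m) by ring,
    show q ^ (m + 1 + (m + 1)) * z * z = z * z * q ^ (m + 1 + (m + 1)) by ring]
  rw [← mul_sub, show z * q ^ (m + 1) - z = z * (q ^ (m + 1) - 1) by ring,
    mul_div_mul_left _ _ hz] at hfactor
  generalize segmentFactor q z z k (m + 1) = A at *
  generalize (1 : ℂ) - z * z * q ^ (m + m) = C at *
  generalize (1 : ℂ) - z * z * q ^ (m + 1 + (m + 1)) = C' at *
  generalize (1 : ℂ) - z * z * q ^ (m + 1 + k) = D at *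
  generalize q ^ (m + 1) - 1 = E at *
  field_simp
  field_simp at hfactor
  linear_combination (-(-1) ^ m / (1 - z ^ 2)) * hfactor

theorem pairProd_pairWeight_segmentPoint_succ (hm : m < k) :
    pairProd (Finset.range k) (fun i j =>
        pairWeight q (segmentPoint q z (m + 1) i) (segmentPoint q z (m + 1) j)) *
        ∏ i ∈ (Finset.range k).erase m,
          pairWeight q (reflect q (z * q ^ m)) (segmentPoint q z m i) =
      pairProd (Finset.range k) (fun i j =>
        pairWeight q (segmentPoint q z m i) (segmentPoint q z m j)) *
        ∏ i ∈ (Finset.range k).erase m, pairWeight q (z * q ^ m) (segmentPoint q z m i) := by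
  have hrest : ∀ i ∈ (Finset.range k).erase m,
      segmentPoint q z (m + 1) i = segmentPoint q z m i := fun i hi => by
    have := Finset.ne_of_mem_erase hi
    simp only [segmentPoint, show i < m + 1 ↔ i < m by omega]
  have hsplit : ∀ l, pairProd (Finset.range k) (fun i j =>
      pairWeight q (segmentPoint q z l i) (segmentPoint q z l j)) =
      (∏ i ∈ (Finset.range k).erase m,
        pairWeight q (segmentPoint q z l m) (segmentPoint q z l i)) *
      pairProd ((Finset.range k).erase m) (fun i j =>
        pairWeight q (segmentPoint q z l i) (segmentPoint q z l j)) := fun l => by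
    conv_lhs => rw [← Finset.insert_erase (Finset.mem_range.2 hm)]
    rw [pairProd_insert (Finset.notMem_erase _ _) fun _ _ => pairWeight_comm _ _ _]
    simp only [pairWeight_comm q _ (segmentPoint q z l m)]
  have hm' : segmentPoint q z m m = reflect q (z * q ^ m) := if_neg (lt_irrefl m)
  have hm1 : segmentPoint q z (m + 1) m = z * q ^ m := if_pos m.lt_succ_self
  rw [hsplit m, hsplit (m + 1), hm', hm1,
    pairProd_congr fun i hi j hj _ => by rw [hrest i hi, hrest j hj],
    Finset.prod_congr rfl fun i hi => by rw [hrest i hi]]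
  ring

theorem pairProd_pairWeight_segmentPoint (hq0 : q ≠ 0) (hq : ¬IsOfFinOrder q) (hz : z ≠ 0)
    (h : ∀ j ≤ k + k, 1 - z * z * q ^ j ≠ 0) (hm : m ≤ k) :
    pairProd (Finset.range k) (fun i j =>
      pairWeight q (segmentPoint q z m i) (segmentPoint q z m j)) =
        qPoch (q * z ^ 2) (q ^ 2) k / qPoch (q * z ^ 2) q k * selfFactor q z k m := by
  induction m with
  | zero =>
    have h0 : 1 - z * z ≠ 0 := by simpa using h 0 (Nat.zero_le _)
    have hden : qPoch (q * z ^ 2) q k ≠ 0 := qPoch_ne_zero_iff.2 fun j hj => by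
      rw [show q * z ^ 2 * q ^ j = z * z * q ^ (j + 1) by ring]
      exact h _ (by omega)
    simp only [segmentPoint, Nat.not_lt_zero, if_false]
    rw [eq_div_of_mul_eq hden (pairProd_pairWeight_reflect hq0 hz h)]
    simp [selfFactor, segmentFactor, qPoch, h0]
  | succ m ih =>
    refine mul_right_cancel₀ (prod_erase_pairWeight_row_reflect_ne_zero hq0 hq hz h hm) ?_
    rw [pairProd_pairWeight_segmentPoint_succ hm, ih (by omega), mul_assoc, mul_assoc,
      selfFactor_succ_mul_row hq0 hq hz h hm]

end SelfBlock

section Segments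

variable {s : ℕ} {q : ℂ} {z : Fin s → ℂ} {k m : Fin s → ℕ}

/-- The index set of the pairs `(l, j)` with `j < m l`, ordered lexicographically. -/
def segmentSet (m : Fin s → ℕ) : Finset (Fin s ×ₗ ℕ) :=
  (Finset.univ.sigma fun l => Finset.range (m l)).map
    ((Equiv.sigmaEquivProd (Fin s) ℕ).trans toLex).toEmbedding

/-- The variables of a multiple principal specialization: geometric progressions of ratio `q`
starting at the points `z l`. -/
noncomputable def segmentVar (q : ℂ) (z : Fin s → ℂ) (p : Fin s ×ₗ ℕ) : ℂ :=
  z (ofLex p).1 * q ^ (ofLex p).2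

theorem mem_segmentSet {l : Fin s} {j : ℕ} : toLex (l, j) ∈ segmentSet m ↔ j < m l := by
  simp [segmentSet]

theorem prod_segmentSet (m : Fin s → ℕ) (F : Fin s ×ₗ ℕ → ℂ) :
    ∏ p ∈ segmentSet m, F p = ∏ l, ∏ j ∈ Finset.range (m l), F (toLex (l, j)) := by
  rw [segmentSet, Finset.prod_map, Finset.prod_sigma]
  rfl

theorem card_segmentSet (m : Fin s → ℕ) : (segmentSet m).card = ∑ l, m l := by
  simp [segmentSet]

theorem segmentSet_subset_segmentSet : segmentSet m ⊆ segmentSet k ↔ m ≤ k := by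
  refine ⟨fun h l => le_of_not_gt fun hl => ?_, fun h p hp => ?_⟩
  · exact lt_irrefl _ (mem_segmentSet.1 (h (mem_segmentSet.2 hl)))
  · obtain ⟨⟨l, j⟩, rfl⟩ := toLex.surjective p
    exact mem_segmentSet.2 ((mem_segmentSet.1 hp).trans_le (h l))

theorem segmentSet_injective : Function.Injective (segmentSet (s := s)) := fun _ _ h =>
  le_antisymm (segmentSet_subset_segmentSet.1 h.subset) (segmentSet_subset_segmentSet.1 h.superset)

theorem exists_segmentSet_eq {S : Finset (Fin s ×ₗ ℕ)} (hS : S ⊆ segmentSet k)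
    (hdown : ∀ l j, toLex (l, j + 1) ∈ S → toLex (l, j) ∈ S) : ∃ m ≤ k, segmentSet m = S := by
  classical
  have hnotMem : ∀ l, toLex (l, k l) ∉ S := fun l h => lt_irrefl _ (mem_segmentSet.1 (hS h))
  have hex : ∀ l, ∃ j, toLex (l, j) ∉ S := fun l => ⟨k l, hnotMem l⟩
  refine ⟨fun l => Nat.find (hex l), fun l => Nat.find_min' (hex l) (hnotMem l), ?_⟩
  have hup : ∀ l j, Nat.find (hex l) ≤ j → toLex (l, j) ∉ S := fun l j hj => by
    induction j, hj using Nat.le_induction with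
    | base => exact Nat.find_spec (hex l)
    | succ j _ ih => exact fun h => ih (hdown l j h)
  ext p
  obtain ⟨⟨l, j⟩, rfl⟩ := toLex.surjective p
  rw [mem_segmentSet]
  exact ⟨fun h => not_not.1 (Nat.find_min (hex l) h), fun h => not_le.1 fun hle => hup l j hle h⟩

theorem pairProd_segmentSet (k : Fin s → ℕ) (g : Fin s ×ₗ ℕ → Fin s ×ₗ ℕ → ℂ) :
    pairProd (segmentSet k) g =
      (∏ a, pairProd (Finset.range (k a)) fun i j => g (toLex (a, i)) (toLex (a, j))) *
      ∏ a, ∏ b ∈ Finset.Ioi a, ∏ i ∈ Finset.range (k a), ∏ j ∈ Finset.range (k b),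
        g (toLex (a, i)) (toLex (b, j)) := by
  simp only [pairProd, Finset.prod_filter, prod_segmentSet, ← Finset.prod_mul_distrib,
    Prod.Lex.toLex_lt_toLex]
  refine Finset.prod_congr rfl fun a _ => ?_
  rw [Finset.prod_comm, ← Finset.prod_subset (Finset.subset_univ (Finset.Ici a)),
    ← Finset.Ioi_insert, Finset.prod_insert Finset.notMem_Ioi_self]
  · congr 1
    · simp
    · refine Finset.prod_congr rfl fun b hb => ?_
      simp [Finset.mem_Ioi.1 hb]
  · intro b _ hb
    have hlt : b < a := by simpa using hb
    simp [hlt.not_gt, hlt.ne']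

theorem signedPoint_segmentSet (q : ℂ) (z : Fin s → ℂ) (m : Fin s → ℕ) (l : Fin s) (j : ℕ) :
    signedPoint q (segmentVar q z) (segmentSet m) (toLex (l, j)) =
      segmentPoint q (z l) (m l) j := by
  simp [signedPoint, segmentPoint, segmentVar, mem_segmentSet]

theorem reflectionTerm_segmentSet (q : ℂ) (z : Fin s → ℂ) (k m : Fin s → ℕ) (f : ℂ → ℂ) :
    reflectionTerm q (segmentSet k) f (signedPoint q (segmentVar q z) (segmentSet m)) =
      (∏ l, ∏ j ∈ Finset.range (k l), f (segmentPoint q (z l) (m l) j)) *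
        ((∏ a, pairProd (Finset.range (k a)) fun i j =>
          pairWeight q (segmentPoint q (z a) (m a) i) (segmentPoint q (z a) (m a) j)) *
        ∏ a, ∏ b ∈ Finset.Ioi a, ∏ i ∈ Finset.range (k a), ∏ j ∈ Finset.range (k b),
          pairWeight q (segmentPoint q (z a) (m a) i) (segmentPoint q (z b) (m b) j)) := by
  simp only [reflectionTerm, prod_segmentSet, pairProd_segmentSet, signedPoint_segmentSet]

theorem pairWeight_reflect_mul_eq_zero {x : ℂ} (hq : q ≠ 0) (hx : x ≠ 0) :
    pairWeight q (reflect q x) (x * q) = 0 := by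
  rw [pairWeight, reflect, mul_comm x, inv_mul_cancel₀ (mul_ne_zero hq hx), sub_self, mul_zero,
    zero_div]

theorem reflectionTerm_segmentVar_eq_zero (hq : q ≠ 0) (hz : ∀ l, z l ≠ 0)
    {S : Finset (Fin s ×ₗ ℕ)} (hS : S ⊆ segmentSet k) {l : Fin s} {j : ℕ}
    (hsucc : toLex (l, j + 1) ∈ S) (hj : toLex (l, j) ∉ S) (f : ℂ → ℂ) :
    reflectionTerm q (segmentSet k) f (signedPoint q (segmentVar q z) S) = 0 := by
  have hlt : j + 1 < k l := mem_segmentSet.1 (hS hsucc)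
  refine mul_eq_zero_of_right _ (Finset.prod_eq_zero (mem_segmentSet.2 (j.lt_succ_self.trans hlt))
    (Finset.prod_eq_zero (Finset.mem_filter.2 ⟨hS hsucc, ?_⟩) ?_))
  · simp [Prod.Lex.toLex_lt_toLex]
  · simp only [signedPoint, if_neg hj, if_pos hsucc, segmentVar, ofLex_toLex, pow_succ, ← mul_assoc]
    exact pairWeight_reflect_mul_eq_zero hq (mul_ne_zero (hz l) (pow_ne_zero j hq))

/-- An unreflected point annihilates a reflected predecessor in its segment. -/
theorem reflectionSum_segmentSet (hq : q ≠ 0) (hz : ∀ l, z l ≠ 0) (f : ℂ → ℂ) :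
    reflectionSum q (segmentVar q z) (segmentSet k) f = ∑ m ∈ Finset.Iic k,
      reflectionTerm q (segmentSet k) f (signedPoint q (segmentVar q z) (segmentSet m)) := by
  have hsub : (Finset.Iic k).image segmentSet ⊆ (segmentSet k).powerset := fun S hS => by
    obtain ⟨m, hm, rfl⟩ := Finset.mem_image.1 hS
    exact Finset.mem_powerset.2 (segmentSet_subset_segmentSet.2 (Finset.mem_Iic.1 hm))
  rw [reflectionSum, ← Finset.sum_subset hsub, Finset.sum_image segmentSet_injective.injOn]
  intro S hS hS'
  rw [Finset.mem_powerset] at hS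
  obtain ⟨l, j, hsucc, hj⟩ : ∃ l j, toLex (l, j + 1) ∈ S ∧ toLex (l, j) ∉ S := by
    by_contra! hdown
    obtain ⟨m, hm, rfl⟩ := exists_segmentSet_eq hS hdown
    exact hS' (Finset.mem_image_of_mem _ (Finset.mem_Iic.2 hm))
  exact reflectionTerm_segmentVar_eq_zero hq hz hS hsucc hj f

/-- The points `z l * q ^ j`, `j ≤ k l`, are nonzero and lie on distinct orbits of the reflection
`x ↦ 1 / (q x)` for distinct `l`, and the products of the points occurring in a denominator differ
from `1`. -/
structure GenericSegments (q : ℂ) (z : Fin s → ℂ) (k : Fin s → ℕ) : Prop where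
  ne_zero : ∀ l, z l ≠ 0
  one_sub_ne : ∀ a b, ∀ j ≤ k a + k b, 1 - z a * z b * q ^ j ≠ 0
  sub_ne : ∀ a b, a ≠ b → ∀ i ≤ k a, ∀ j ≤ k b, z a * q ^ i - z b * q ^ j ≠ 0

theorem GenericSegments.disjointSegments (h : GenericSegments q z k) {a b : Fin s} (hab : a ≠ b) :
    DisjointSegments q (z a) (z b) (k a) (k b) :=
  ⟨h.ne_zero a, h.ne_zero b, h.one_sub_ne a b, h.sub_ne a b hab⟩

theorem GenericSegments.generic (h : GenericSegments q z k) (hq0 : q ≠ 0)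
    (hq : ¬IsOfFinOrder q) : Generic q (segmentVar q z) (segmentSet k) where
  ne_zero _ _ := mul_ne_zero (h.ne_zero _) (pow_ne_zero _ hq0)
  injOn p hp p' hp' heq := by
    obtain ⟨⟨a, i⟩, rfl⟩ := toLex.surjective p
    obtain ⟨⟨b, j⟩, rfl⟩ := toLex.surjective p'
    have hi := mem_segmentSet.1 hp
    have hj := mem_segmentSet.1 hp'
    obtain rfl : a = b := by
      by_contra hab
      exact h.sub_ne a b hab i hi.le j hj.le (sub_eq_zero.2 heq)
    have hij : i = j :=
      pow_injective_of_not_isOfFinOrder hq0 hq (mul_left_cancel₀ (h.ne_zero a) heq)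
    rw [hij]
  one_sub_ne p hp p' hp' := by
    obtain ⟨⟨a, i⟩, rfl⟩ := toLex.surjective p
    obtain ⟨⟨b, j⟩, rfl⟩ := toLex.surjective p'
    have hi := mem_segmentSet.1 hp
    have hj := mem_segmentSet.1 hp'
    simp only [segmentVar, ofLex_toLex]
    rw [show q * (z a * q ^ i) * (z b * q ^ j) = z a * z b * q ^ (i + j + 1) by ring]
    exact h.one_sub_ne a b _ (by omega)

theorem prod_selfFactor_mul_prod_crossFactor (q : ℂ) (z : Fin s → ℂ) (k m : Fin s → ℕ) :
    (∏ a, selfFactor q (z a) (k a) (m a)) *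
        ∏ a, ∏ b ∈ Finset.Ioi a, crossFactor q (z a) (z b) (k a) (k b) (m a) (m b) =
      (-1) ^ (∑ l, m l) * q ^ ((∑ l, k l) * ∑ l, m l) * cCoeff k q z m := by
  have hpow : q ^ ((∑ l, k l) * ∑ l, m l) = (∏ a, q ^ (k a * m a)) *
      ∏ a, ∏ b ∈ Finset.Ioi a, q ^ (k b * m a + k a * m b) := by
    simp only [pow_add]
    rw [← prod_prod_eq_diag_mul_Ioi fun a b => q ^ (k b * m a), mul_comm, Finset.sum_mul_sum,
      ← Finset.prod_pow_eq_pow_sum]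
    simp only [Finset.prod_pow_eq_pow_sum, mul_comm]
  rw [hpow, cCoeff, prod_prod_eq_diag_mul_Ioi, prod_Ici_eq_diag_mul_Ioi,
    ← Finset.prod_pow_eq_pow_sum]
  simp only [selfFactor, crossFactor, segmentFactor, Finset.prod_mul_distrib]
  ring

theorem reflectionSum_segmentSet_eq_sum_cCoeff (hq0 : q ≠ 0) (hq : ¬IsOfFinOrder q)
    (h : GenericSegments q z k) (f : ℂ → ℂ) :
    reflectionSum q (segmentVar q z) (segmentSet k) f =
      (∏ a, ∏ b ∈ Finset.Ioi a,
        qPoch (q ^ (k b + 1) * z a * z b) q (k a) / qPoch (q * z a * z b) q (k a)) *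
      (∏ a, qPoch (q * z a ^ 2) (q ^ 2) (k a) / qPoch (q * z a ^ 2) q (k a)) *
      ∑ m ∈ Finset.Iic k, (-1) ^ (∑ l, m l) * q ^ ((∑ l, k l) * ∑ l, m l) * cCoeff k q z m *
        ∏ l, ∏ j ∈ Finset.range (k l), f (segmentPoint q (z l) (m l) j) := by
  rw [reflectionSum_segmentSet hq0 h.ne_zero, Finset.mul_sum]
  refine Finset.sum_congr rfl fun m hm => ?_
  have hmk : ∀ l, m l ≤ k l := Finset.mem_Iic.1 hm
  rw [reflectionTerm_segmentSet, ← prod_selfFactor_mul_prod_crossFactor,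
    Finset.prod_congr rfl fun a _ => pairProd_pairWeight_segmentPoint hq0 hq (h.ne_zero a)
      (h.one_sub_ne a a) (hmk a),
    Finset.prod_congr rfl fun a _ => Finset.prod_congr rfl fun b hb =>
      (h.disjointSegments (Finset.mem_Ioi.1 hb).ne).prod_pairWeight hq0 (hmk a) (hmk b)]
  simp only [Finset.prod_mul_distrib]
  ring

end Segments

section SegmentWeights

variable {n : ℕ} {q w : ℂ}

theorem pointWeight_reflect (hq : q ≠ 0) (hw : w ≠ 0) (n : ℕ) {x : ℂ} (hx : x ≠ 0) :
    pointWeight q (q ^ n * w) (q / w) (reflect q x) =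
      -(q * x)⁻¹ * (q ^ n * ((1 - w * x) * (1 - q ^ (1 - (n : ℤ)) / w * x))) := by
  rw [pointWeight, reflect, zpow_sub₀ hq, zpow_one, zpow_natCast]
  field_simp
  ring

theorem latticePoint_sub_orbitSum (hq : q ≠ 0) (hw : w ≠ 0) (i : ℕ) {x : ℂ} (hx : x ≠ 0) :
    latticePoint q w i - orbitSum q x =
      -(q * x)⁻¹ * ((1 - q ^ i * w * x) * (1 - q ^ (1 - (i : ℤ)) / w * x)) := by
  rw [latticePoint, orbitSum, orbitSum, reflect, reflect, zpow_sub₀ hq, zpow_one, zpow_natCast]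
  field_simp
  ring

theorem pointWeight_eq_reflect_mul (hq : q ≠ 0) (hw : w ≠ 0) {x : ℂ} (hx : x ≠ 0)
    (h : 1 - w * x ≠ 0) (h' : 1 - q ^ (1 - (n : ℤ)) / w * x ≠ 0) :
    pointWeight q (q ^ n * w) (q / w) x = pointWeight q (q ^ n * w) (q / w) (reflect q x) *
      ((q ^ n)⁻¹ * ((1 - q ^ n * w * x) / (1 - w * x) *
        ((1 - q / w * x) / (1 - q ^ (1 - (n : ℤ)) / w * x)))) := by
  rw [pointWeight_reflect hq hw n hx, pointWeight]
  generalize 1 - w * x = A at *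
  generalize 1 - q ^ (1 - (n : ℤ)) / w * x = B at *
  field_simp

variable {z : ℂ} {k m : ℕ}

theorem prod_one_sub_mul_eq_qPoch (c : ℂ) (q z : ℂ) (k : ℕ) :
    ∏ j ∈ Finset.range k, (1 - c * (z * q ^ j)) = qPoch (c * z) q k := by
  simp only [qPoch, mul_assoc]

theorem prod_pointWeight_reflect (hq : q ≠ 0) (hw : w ≠ 0) (hz : z ≠ 0) (n k : ℕ) :
    ∏ j ∈ Finset.range k, pointWeight q (q ^ n * w) (q / w) (reflect q (z * q ^ j)) =
      (∏ j ∈ Finset.range k, -(q * (z * q ^ j))⁻¹) *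
        (q ^ (n * k) * (qPoch (w * z) q k * qPoch (q ^ (1 - (n : ℤ)) / w * z) q k)) := by
  rw [Finset.prod_congr rfl fun j _ =>
    pointWeight_reflect hq hw n (mul_ne_zero hz (pow_ne_zero j hq))]
  simp only [Finset.prod_mul_distrib, prod_one_sub_mul_eq_qPoch, Finset.prod_const,
    Finset.card_range, pow_mul]

theorem prod_latticePoint_sub_orbitSum (hq : q ≠ 0) (hw : w ≠ 0) (hz : z ≠ 0) (i k : ℕ) :
    ∏ j ∈ Finset.range k, (latticePoint q w i - orbitSum q (z * q ^ j)) =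
      (∏ j ∈ Finset.range k, -(q * (z * q ^ j))⁻¹) *
        (qPoch (q ^ i * w * z) q k * qPoch (q ^ (1 - (i : ℤ)) / w * z) q k) := by
  rw [Finset.prod_congr rfl fun j _ =>
    latticePoint_sub_orbitSum hq hw i (mul_ne_zero hz (pow_ne_zero j hq))]
  simp only [Finset.prod_mul_distrib, prod_one_sub_mul_eq_qPoch]

theorem prod_pointWeight_reflect_ne_zero (hq : q ≠ 0) (hw : w ≠ 0) (hz : z ≠ 0)
    (h : qPoch (w * z) q k ≠ 0) (h' : qPoch (q ^ (1 - (n : ℤ)) * z / w) q k ≠ 0) :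
    ∏ j ∈ Finset.range k, pointWeight q (q ^ n * w) (q / w) (reflect q (z * q ^ j)) ≠ 0 := by
  rw [prod_pointWeight_reflect hq hw hz, div_mul_eq_mul_div]
  refine mul_ne_zero (Finset.prod_ne_zero_iff.2 fun j _ => ?_)
    (mul_ne_zero (pow_ne_zero _ hq) (mul_ne_zero h h'))
  exact neg_ne_zero.2 (inv_ne_zero (mul_ne_zero hq (mul_ne_zero hz (pow_ne_zero j hq))))

theorem prod_pointWeight_segmentPoint (hq : q ≠ 0) (hw : w ≠ 0) (hz : z ≠ 0) (hm : m ≤ k)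
    (h : qPoch (w * z) q k ≠ 0) (h' : qPoch (q ^ (1 - (n : ℤ)) * z / w) q k ≠ 0) :
    ∏ j ∈ Finset.range k, pointWeight q (q ^ n * w) (q / w) (segmentPoint q z m j) =
      (∏ j ∈ Finset.range k, pointWeight q (q ^ n * w) (q / w) (reflect q (z * q ^ j))) *
        ((q ^ (n * m))⁻¹ * (qPoch (q ^ n * w * z) q m / qPoch (w * z) q m *
          (qPoch (q * z / w) q m / qPoch (q ^ (1 - (n : ℤ)) * z / w) q m))) := by
  obtain ⟨d, rfl⟩ := Nat.exists_eq_add_of_le hm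
  rw [mul_div_right_comm] at h' ⊢
  rw [mul_div_right_comm, Finset.prod_range_add, Finset.prod_range_add,
    Finset.prod_congr rfl fun j hj => by
      have hjm := Finset.mem_range.1 hj
      rw [segmentPoint, if_pos hjm, pointWeight_eq_reflect_mul hq hw
        (mul_ne_zero hz (pow_ne_zero j hq))
        (by simpa only [mul_assoc] using qPoch_ne_zero_iff.1 h j (by omega))
        (by simpa only [mul_assoc] using qPoch_ne_zero_iff.1 h' j (by omega))]]
  simp only [segmentPoint, Nat.not_lt.2 (Nat.le_add_right m _), if_false,
    Finset.prod_mul_distrib, Finset.prod_div_distrib, prod_one_sub_mul_eq_qPoch, Finset.prod_const,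
    Finset.card_range, pow_mul, inv_pow]
  ring

theorem qPoch_ratio_mul_prod_pointWeight_reflect (hq : q ≠ 0) (hw : w ≠ 0) (hz : z ≠ 0) {i : ℕ}
    (hi : i ≤ n) (h3 : qPoch (w / z) q n ≠ 0) (h4 : qPoch (q ^ (-(k : ℤ)) * w / z) q n ≠ 0)
    (h5 : qPoch (w * z) q n ≠ 0) :
    qPoch (q ^ (-(k : ℤ)) * w / z) q n / qPoch (w / z) q n *
        ((q ^ k)⁻¹ ^ i * (qPoch (w / z) q i * qPoch (q ^ k * w * z) q i /
          (qPoch (w * z) q i * qPoch (q ^ (-(k : ℤ)) * w / z) q i))) *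
        ∏ j ∈ Finset.range k, pointWeight q (q ^ n * w) (q / w) (reflect q (z * q ^ j)) =
      ∏ j ∈ Finset.range k, (latticePoint q w i - orbitSum q (z * q ^ j)) := by
  have hswap : qPoch (w * z) q i * qPoch (q ^ i * w * z) q k =
      qPoch (w * z) q k * qPoch (q ^ k * w * z) q i := by
    rw [show q ^ i * w * z = w * z * q ^ i by ring, show q ^ k * w * z = w * z * q ^ k by ring,
      ← qPoch_add, ← qPoch_add, add_comm]
  have hrev : ∀ t : ℕ, q ^ (t * k) * qPoch (q ^ (1 - (t : ℤ)) / w * z) q k *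
      qPoch (q ^ (-(k : ℤ)) * w / z) q t =
      qPoch (q * (z / w)) q k * qPoch (w / z) q t := fun t => by
    rw [div_mul_eq_mul_div, mul_div_assoc, ← inv_div z w, ← qPoch_mul_qPoch_inv hq
      (div_ne_zero hz hw), div_div_eq_mul_div]
  have hrevn := hrev n
  have hrevi := hrev i
  have h4i := qPoch_ne_zero_of_le hi h4
  have h5i := qPoch_ne_zero_of_le hi h5
  rw [prod_pointWeight_reflect hq hw hz, prod_latticePoint_sub_orbitSum hq hw hz]
  generalize qPoch (q ^ (-(k : ℤ)) * w / z) q n = A at *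
  generalize qPoch (q ^ (-(k : ℤ)) * w / z) q i = A' at *
  generalize qPoch (w / z) q n = B at *
  generalize qPoch (w / z) q i = B' at *
  generalize qPoch (w * z) q i = D at *
  generalize qPoch (w * z) q k = D' at *
  generalize qPoch (q ^ k * w * z) q i = F at *
  generalize qPoch (q ^ i * w * z) q k = F' at *
  generalize qPoch (q ^ (1 - (n : ℤ)) / w * z) q k = P at *
  generalize qPoch (q ^ (1 - (i : ℤ)) / w * z) q k = P' at *
  generalize qPoch (q * (z / w)) q k = E at *
  generalize ∏ j ∈ Finset.range k, -(q * (z * q ^ j))⁻¹ = M at *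
  have hcross : q ^ (n * k) * P * A * B' = q ^ (i * k) * P' * A' * B := by
    rw [hrevn, hrevi]
    ring
  rw [inv_pow, ← pow_mul, mul_comm k]
  generalize q ^ (n * k) = Q at *
  have hQ' : q ^ (i * k) ≠ 0 := pow_ne_zero _ hq
  generalize q ^ (i * k) = Q' at *
  field_simp
  linear_combination M * D' * F * hcross - M * B * Q' * A' * P' * hswap

end SegmentWeights

section TransformationFormula

variable {s n : ℕ} {k : Fin s → ℕ} {q w : ℂ} {z : Fin s → ℂ}

theorem phiTerm_eq_baileyTerm_mul_prod (n : ℕ) (k : Fin s → ℕ) (hq : q ≠ 0) (w : ℂ)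
    (z : Fin s → ℂ) (i : ℕ) :
    phiTerm (upperParams n k q w z) (lowerParams n k q w z) q
        (-q ^ ((n : ℤ) - (∑ l, k l : ℕ) + 1)) i =
      baileyTerm q w n i *
        ∏ l, ((q ^ k l)⁻¹ ^ i * (qPoch (w / z l) q i * qPoch (q ^ k l * w * z l) q i /
          (qPoch (w * z l) q i * qPoch (q ^ (-(k l : ℤ)) * w / z l) q i))) := by
  have hx : -q ^ ((n : ℤ) - (∑ l, k l : ℕ) + 1) = -q ^ (n + 1) * ∏ l, (q ^ k l)⁻¹ := by
    rw [Finset.prod_inv_distrib, Finset.prod_pow_eq_pow_sum, sub_add_eq_add_sub, zpow_sub₀ hq,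
      zpow_natCast, ← Nat.cast_add_one, zpow_natCast, neg_mul, div_eq_mul_inv]
  rw [phiTerm, baileyTerm, upperParams, lowerParams, hx, Fin.prod_univ_succ, Fin.prod_univ_succ,
    Fin.prod_univ_succ, mul_pow]
  simp only [Fin.cons_zero, Fin.cons_succ, Fin.prod_univ_add, Fin.append_left, Fin.append_right,
    Finset.prod_mul_distrib, Finset.prod_div_distrib, Finset.prod_pow]
  simp only [div_eq_mul_inv, mul_inv]
  ring

theorem phiTerm_eq_zero_of_notMem_range (k : Fin s → ℕ) (hq : q ≠ 0) (w : ℂ) (z : Fin s → ℂ)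
    {i : ℕ} (hi : i ∉ Finset.range (n + 1)) :
    phiTerm (upperParams n k q w z) (lowerParams n k q w z) q
      (-q ^ ((n : ℤ) - (∑ l, k l : ℕ) + 1)) i = 0 := by
  rw [phiTerm_eq_baileyTerm_mul_prod n k hq, baileyTerm,
    qPoch_zpow_neg_eq_zero hq (by simpa using hi)]
  simp

theorem summable_phiTerm (n : ℕ) (k : Fin s → ℕ) (hq : q ≠ 0) (w : ℂ) (z : Fin s → ℂ) :
    Summable (phiTerm (upperParams n k q w z) (lowerParams n k q w z) q
      (-q ^ ((n : ℤ) - (∑ l, k l : ℕ) + 1))) :=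
  summable_of_ne_finset_zero fun _ => phiTerm_eq_zero_of_notMem_range k hq w z

/-- The product of the point weights over all reflected segments, that is, the weight of the
summand `m = 0`; multiplying by it clears the denominators on both sides of the identity. -/
noncomputable def reflectedWeight (n : ℕ) (k : Fin s → ℕ) (q w : ℂ) (z : Fin s → ℂ) : ℂ :=
  ∏ l, ∏ j ∈ Finset.range (k l), pointWeight q (q ^ n * w) (q / w) (reflect q (z l * q ^ j))

theorem reflectedWeight_ne_zero (hq : q ≠ 0) (hw : w ≠ 0) (hz : ∀ l, z l ≠ 0)
    (h : ∀ l, qPoch (w * z l) q (k l) ≠ 0)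
    (h' : ∀ l, qPoch (q ^ (1 - (n : ℤ)) * z l / w) q (k l) ≠ 0) :
    reflectedWeight n k q w z ≠ 0 :=
  Finset.prod_ne_zero_iff.2 fun l _ =>
    prod_pointWeight_reflect_ne_zero hq hw (hz l) (h l) (h' l)

theorem phi_mul_reflectedWeight_eq_baileyFunctional (hq : q ≠ 0) (hw : w ≠ 0) (hz : ∀ l, z l ≠ 0)
    (h3 : ∀ l, qPoch (w / z l) q n ≠ 0)
    (h4 : ∀ l, qPoch (q ^ (-(k l : ℤ)) * w / z l) q n ≠ 0)
    (h5 : ∀ l, qPoch (w * z l) q n ≠ 0) :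
    qPoch (q * w ^ 2) (q ^ 2) n / qPoch (w ^ 2) q n *
        (∏ l, qPoch (q ^ (-(k l : ℤ)) * w / z l) q n / qPoch (w / z l) q n) *
        phi (upperParams n k q w z) (lowerParams n k q w z) q
          (-q ^ ((n : ℤ) - (∑ l, k l : ℕ) + 1)) * reflectedWeight n k q w z =
      baileyFunctional q w n fun ξ =>
        ∏ t ∈ segmentSet k, (ξ - orbitSum q (segmentVar q z t)) := by
  rw [phi, tsum_eq_sum fun _ => phiTerm_eq_zero_of_notMem_range k hq w z, baileyFunctional,
    mul_assoc, mul_assoc]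
  congr 1
  rw [Finset.sum_mul, Finset.mul_sum]
  refine Finset.sum_congr rfl fun i hi => ?_
  rw [phiTerm_eq_baileyTerm_mul_prod n k hq, reflectedWeight, mul_assoc, mul_left_comm,
    ← Finset.prod_mul_distrib, ← Finset.prod_mul_distrib, prod_segmentSet]
  congr 1
  refine Finset.prod_congr rfl fun l _ => ?_
  rw [← mul_assoc, qPoch_ratio_mul_prod_pointWeight_reflect hq hw (hz l)
    (Nat.lt_succ_iff.1 (Finset.mem_range.1 hi)) (h3 l) (h4 l) (h5 l)]
  rfl

theorem typeCSum_segmentSet (hq0 : q ≠ 0) (hq : ¬ IsOfFinOrder q) (hw : w ≠ 0)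
    (hz : GenericSegments q z k) (h : ∀ l, qPoch (w * z l) q (k l) ≠ 0)
    (h' : ∀ l, qPoch (q ^ (1 - (n : ℤ)) * z l / w) q (k l) ≠ 0) :
    typeCSum q (segmentVar q z) (segmentSet k) (q ^ n * w) (q / w) =
      (∏ a, ∏ b ∈ Finset.Ioi a,
        qPoch (q ^ (k b + 1) * z a * z b) q (k a) / qPoch (q * z a * z b) q (k a)) *
      (∏ a, qPoch (q * z a ^ 2) (q ^ 2) (k a) / qPoch (q * z a ^ 2) q (k a)) *
      (∑ m ∈ Finset.Iic k,
        (-1) ^ (∑ l, m l) * cCoeff k q z m *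
          q ^ ((((∑ l, k l : ℕ) : ℤ) - n) * (∑ l, m l : ℕ)) *
          ∏ l, (qPoch (q ^ n * w * z l) q (m l) / qPoch (w * z l) q (m l)) *
            (qPoch (q * z l / w) q (m l) / qPoch (q ^ (1 - (n : ℤ)) * z l / w) q (m l))) *
      reflectedWeight n k q w z := by
  rw [typeCSum, reflectionSum_segmentSet_eq_sum_cCoeff hq0 hq hz, mul_assoc _ (∑ m ∈ _, _),
    Finset.sum_mul]
  congr 1
  refine Finset.sum_congr rfl fun m hm => ?_
  have hpow : q ^ ((((∑ l, k l : ℕ) : ℤ) - n) * (∑ l, m l : ℕ)) =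
      q ^ ((∑ l, k l) * ∑ l, m l) * ∏ l, (q ^ (n * m l))⁻¹ := by
    rw [sub_mul, zpow_sub₀ hq0, ← Nat.cast_mul, ← Nat.cast_mul, zpow_natCast, zpow_natCast,
      div_eq_mul_inv, Finset.prod_inv_distrib, Finset.prod_pow_eq_pow_sum, ← Finset.mul_sum]
  rw [Finset.prod_congr rfl fun l _ => prod_pointWeight_segmentPoint hq0 hw (hz.ne_zero l)
    (Finset.mem_Iic.1 hm l) (h l) (h' l), hpow, reflectedWeight]
  simp only [Finset.prod_mul_distrib]
  ring

theorem one_sub_sq_mul_pow_ne_zero (h : qPoch (w ^ 2) q n ≠ 0)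
    (h' : qPoch (q ^ n * w ^ 2) q n ≠ 0) : ∀ j < 2 * n, 1 - w ^ 2 * q ^ j ≠ 0 := by
  rw [← qPoch_ne_zero_iff, two_mul, qPoch_add, mul_comm (w ^ 2)]
  exact mul_ne_zero h h'

theorem one_sub_mul_pow_ne_zero_of_qPoch {q u : ℂ} {p r : ℕ} (h0 : 1 - u ≠ 0)
    (h : qPoch (q * u) q p ≠ 0) (h' : qPoch (q ^ (1 + p) * u) q r ≠ 0) :
    ∀ j ≤ p + r, 1 - u * q ^ j ≠ 0 := by
  have hall : qPoch u q (1 + p + r) ≠ 0 := by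
    rw [qPoch_add, qPoch_add, pow_one, mul_comm u, mul_comm u]
    exact mul_ne_zero (mul_ne_zero (by simpa [qPoch] using h0) h) h'
  exact fun j hj => qPoch_ne_zero_iff.1 hall j (by omega)

theorem mul_pow_sub_mul_pow_ne_zero {q x y : ℂ} {k i j : ℕ} (hq : q ≠ 0) (hy : y ≠ 0)
    (h : qPoch (q * x / y) q k ≠ 0) (hji : j < i) (hik : i ≤ k) :
    x * q ^ i - y * q ^ j ≠ 0 := by
  obtain ⟨t, rfl⟩ := Nat.exists_eq_add_of_lt hji
  have hfactor : x * q ^ (j + t + 1) - y * q ^ j =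
      -(y * q ^ j) * (1 - q * x / y * q ^ t) := by
    field_simp
    ring
  rw [hfactor]
  exact mul_ne_zero (neg_ne_zero.2 (mul_ne_zero hy (pow_ne_zero j hq)))
    (qPoch_ne_zero_iff.1 h t (by omega))

theorem genericSegments_of_qPoch_ne_zero (hq : q ≠ 0) (hz : ∀ l, z l ≠ 0)
    (hzz : ∀ a b, a ≠ b → z a ≠ z b)
    (h7 : ∀ a b, a ≤ b → 1 - z a * z b ≠ 0)
    (h8 : ∀ a b, a ≤ b → qPoch (q * z a * z b) q (k a) ≠ 0)
    (h9 : ∀ a b, qPoch (q * z a / z b) q (k a) ≠ 0)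
    (h10 : ∀ a b, qPoch (q ^ (1 + k b) * z a * z b) q (k a) ≠ 0) : GenericSegments q z k where
  ne_zero := hz
  one_sub_ne := by
    have hle : ∀ a b, a ≤ b → ∀ j ≤ k a + k b, 1 - z a * z b * q ^ j ≠ 0 := fun a b hab =>
      one_sub_mul_pow_ne_zero_of_qPoch (h7 a b hab) (by simpa only [mul_assoc] using h8 a b hab)
        (by simpa only [mul_assoc, mul_comm (z b)] using h10 b a)
    intro a b
    rcases le_total a b with hab | hba
    · exact hle a b hab
    · rw [add_comm, mul_comm (z a)]
      exact hle b a hba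
  sub_ne a b hab i hi j hj := by
    rcases lt_trichotomy i j with hij | rfl | hji
    · rw [← neg_sub]
      exact neg_ne_zero.2 (mul_pow_sub_mul_pow_ne_zero hq (hz a) (h9 b a) hij hj)
    · rw [← sub_mul]
      exact mul_ne_zero (sub_ne_zero.2 (hzz a b hab)) (pow_ne_zero i hq)
    · exact mul_pow_sub_mul_pow_ne_zero hq (hz b) (h9 a b) hji hi

end TransformationFormula

theorem theorem11_general (s n : ℕ) (k : Fin s → ℕ)
    (q w : ℂ) (z : Fin s → ℂ)
    (hq0 : q ≠ 0) (hq : ¬ IsOfFinOrder q)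
    (hw : w ≠ 0) (hz : ∀ l, z l ≠ 0)
    (hzz : ∀ a b, a ≠ b → z a ≠ z b)
    (hd1 : qPoch (w ^ 2) q n ≠ 0)
    (hd2 : qPoch (q ^ n * w ^ 2) q n ≠ 0)
    (hd3 : ∀ l, qPoch (w / z l) q n ≠ 0)
    (hd4 : ∀ l, qPoch (q ^ (-(k l : ℤ)) * w / z l) q n ≠ 0)
    (hd5 : ∀ l, qPoch (w * z l) q (max n (k l)) ≠ 0)
    (hd6 : ∀ l, qPoch (q ^ (1 - (n : ℤ)) * z l / w) q (k l) ≠ 0)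
    (hd7 : ∀ a b, a ≤ b → 1 - z a * z b ≠ 0)
    (hd8 : ∀ a b, a ≤ b → qPoch (q * z a * z b) q (k a) ≠ 0)
    (hd9 : ∀ a b, qPoch (q * z a / z b) q (k a) ≠ 0)
    (hd10 : ∀ a b, qPoch (q ^ (1 + k b) * z a * z b) q (k a) ≠ 0) :
    Summable (phiTerm (upperParams n k q w z) (lowerParams n k q w z) q
      (-q ^ ((n : ℤ) - (∑ l, k l : ℕ) + 1))) ∧
    qPoch (q * w ^ 2) (q ^ 2) n / qPoch (w ^ 2) q n *
      (∏ l, qPoch (q ^ (-(k l : ℤ)) * w / z l) q n / qPoch (w / z l) q n) *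
      phi (upperParams n k q w z) (lowerParams n k q w z) q
        (-q ^ ((n : ℤ) - (∑ l, k l : ℕ) + 1)) =
    q ^ (-((∑ l, k l).choose 2 : ℤ)) * qPochInt (-q) q ((n : ℤ) - (∑ l, k l : ℕ)) *
      (∏ a, ∏ b ∈ Finset.Ioi a,
        qPoch (q ^ (k b + 1) * z a * z b) q (k a) / qPoch (q * z a * z b) q (k a)) *
      (∏ a, qPoch (q * z a ^ 2) (q ^ 2) (k a) / qPoch (q * z a ^ 2) q (k a)) *
      ∑ m ∈ Finset.Iic k,
        (-1) ^ (∑ l, m l) * cCoeff k q z m *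
          q ^ ((((∑ l, k l : ℕ) : ℤ) - n) * (∑ l, m l : ℕ)) *
          ∏ l, (qPoch (q ^ n * w * z l) q (m l) / qPoch (w * z l) q (m l)) *
            (qPoch (q * z l / w) q (m l) / qPoch (q ^ (1 - (n : ℤ)) * z l / w) q (m l)) := by
  have hw2 := one_sub_sq_mul_pow_ne_zero hd1 hd2
  have hseg := genericSegments_of_qPoch_ne_zero hq0 hz hzz hd7 hd8 hd9 hd10
  have hd5n := fun l => qPoch_ne_zero_of_le (le_max_left n (k l)) (hd5 l)
  have hd5k := fun l => qPoch_ne_zero_of_le (le_max_right n (k l)) (hd5 l)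
  refine ⟨summable_phiTerm n k hq0 w z, ?_⟩
  apply mul_right_cancel₀ (reflectedWeight_ne_zero hq0 hw hz hd5k hd6)
  rw [phi_mul_reflectedWeight_eq_baileyFunctional hq0 hw hz hd3 hd4 hd5n,
    baileyFunctional_prod hq0 hq hw hw2 (hseg.generic hq0 hq), card_segmentSet,
    typeCSum_segmentSet hq0 hq hw hseg hd5k hd6, zpow_neg, zpow_natCast]
  ring

theorem theorem11 (s n : ℕ) (k : Fin s → ℕ) (hk : ∀ l, 0 < k l)
    (q w : ℂ) (z : Fin s → ℂ)
    (hq0 : q ≠ 0) (hq1 : ‖q‖ < 1)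
    -- genericity of `w` and `z`: none of the denominators in the identity vanishes
    (hw : w ≠ 0) (hz : ∀ l, z l ≠ 0)
    (hzz : ∀ a b, a ≠ b → z a ≠ z b)
    (hd1 : qPoch (w ^ 2) q n ≠ 0)
    (hd2 : qPoch (q ^ n * w ^ 2) q n ≠ 0)
    (hd3 : ∀ l, qPoch (w / z l) q n ≠ 0)
    (hd4 : ∀ l, qPoch (q ^ (-(k l : ℤ)) * w / z l) q n ≠ 0)
    (hd5 : ∀ l, qPoch (w * z l) q (max n (k l)) ≠ 0)
    (hd6 : ∀ l, qPoch (q ^ (1 - (n : ℤ)) * z l / w) q (k l) ≠ 0)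
    (hd7 : ∀ a b, a ≤ b → 1 - z a * z b ≠ 0)
    (hd8 : ∀ a b, a ≤ b → qPoch (q * z a * z b) q (k a) ≠ 0)
    (hd9 : ∀ a b, qPoch (q * z a / z b) q (k a) ≠ 0)
    (hd10 : ∀ a b, qPoch (q ^ (1 + k b) * z a * z b) q (k a) ≠ 0) :
    Summable (phiTerm (upperParams n k q w z) (lowerParams n k q w z) q
      (-q ^ ((n : ℤ) - (∑ l, k l : ℕ) + 1))) ∧
    qPoch (q * w ^ 2) (q ^ 2) n / qPoch (w ^ 2) q n *
      (∏ l, qPoch (q ^ (-(k l : ℤ)) * w / z l) q n / qPoch (w / z l) q n) *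
      phi (upperParams n k q w z) (lowerParams n k q w z) q
        (-q ^ ((n : ℤ) - (∑ l, k l : ℕ) + 1)) =
    q ^ (-((∑ l, k l).choose 2 : ℤ)) * qPochInt (-q) q ((n : ℤ) - (∑ l, k l : ℕ)) *
      (∏ a, ∏ b ∈ Finset.Ioi a,
        qPoch (q ^ (k b + 1) * z a * z b) q (k a) / qPoch (q * z a * z b) q (k a)) *
      (∏ a, qPoch (q * z a ^ 2) (q ^ 2) (k a) / qPoch (q * z a ^ 2) q (k a)) *
      ∑ m ∈ Finset.Iic k,
        (-1) ^ (∑ l, m l) * cCoeff k q z m *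
          q ^ ((((∑ l, k l : ℕ) : ℤ) - n) * (∑ l, m l : ℕ)) *
          ∏ l, (qPoch (q ^ n * w * z l) q (m l) / qPoch (w * z l) q (m l)) *
            (qPoch (q * z l / w) q (m l) / qPoch (q ^ (1 - (n : ℤ)) * z l / w) q (m l)) :=
  theorem11_general s n k q w z hq0 (fun hq => hq1.ne hq.norm_eq_one) hw hz hzz hd1 hd2 hd3 hd4
    hd5 hd6 hd7 hd8 hd9 hd10
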